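/- Let $0<a<b$ and $c_l>0$. Let $W^{1,2}_l(0,1)=\{K\in W^{1,2}(0,1): K(0)=0\}$. For measurable $B:(0,1)\to[a,b]$ let $K[B]$ denote the unique global minimiser over $K\in W^{1,2}_l(0,1)$ of the phase energy of a cylindrically deforming clamped plate under gravity, $$\frac12\int_0^1 B(t)\,K'(t)^2\,dt+\int_0^1(1-t)\sin K(t)\,dt .$$ For $\theta\in L^\infty((0,1);[0,1])$ put $B_\theta=(1-\theta)a+\theta b$ and $$\hat{\mathcal J}[\theta]=-\int_0^1(1-t)\sin\big(K[B_\theta](t)\big)\,dt+c_l\int_0^1\theta(t)\,dt .$$ Call $\theta\in L^\infty((0,1);[0,1])$ an optimal design if it minimises $\hat{\mathcal J}$ over $L^\infty((0,1);[0,1])$. Theorem (characterization of optimal designs). Every optimal design $\theta$ has a representative, still denoted by $\theta$ (that is, a function equal to it almost everywhere on $(0,1)$), which is continuous on $[0,1]$ and such that either $\theta\equiv 0$ on $[0,1]$, or there are $0\le t_0<t_1<1$ with the following properties: $\theta=1$ on $(0,t_0)$ (an empty condition if $t_0=0$); $\theta$ is positive and strictly decreasing on $(t_0,t_1)$; $\theta=0$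 on $[t_1,1]$; and $\theta\in C^\infty(t_0,t_1)$. -/

import Mathlib

open MeasureTheory Set
open scoped ContDiff

noncomputable section

namespace PlateDesign

/-- `W^{1,2}_l(0,1)`: the functions in `W^{1,2}(0,1)` that vanish at `0`. In one dimension
`W^{1,2}(0,1)` consists of the absolutely continuous functions on `[0,1]` whose (almost everywhere
defined) derivative is square integrable; only the values on `[0,1]` matter. -/
def W12l : Set (ℝ → ℝ) :=
  {K | AbsolutelyContinuousOnInterval K 0 1 ∧
    MemLp (deriv K) 2 (volume.restrict (Ioo (0 : ℝ) 1)) ∧ K 0 = 0}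

/-- The phase energy `½ ∫ B (K')² - ∫ F · (cos K, 0, sin K)` of a cylindrical plate under gravity
`f = -e₃`, for which `F t = ∫_t^1 f = -(1 - t) e₃`. -/
def phaseEnergy (B K : ℝ → ℝ) : ℝ :=
  (1 / 2) * (∫ t in (0 : ℝ)..1, B t * deriv K t ^ 2)
    - ∫ t in (0 : ℝ)..1, -(1 - t) * Real.sin (K t)

/-- `K` is a global minimiser of the phase energy with hardness `B` within `W^{1,2}_l(0,1)`. -/
def IsPhase (B K : ℝ → ℝ) : Prop :=
  K ∈ W12l ∧ IsMinOn (phaseEnergy B) W12l K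

/-- The phase `K[B]`: the global minimiser of the phase energy within `W^{1,2}_l(0,1)`.
For measurable `B` with values between two positive constants, such a minimiser exists and
its restriction to `[0,1]` is unique. -/
def phase (B : ℝ → ℝ) : ℝ → ℝ := Classical.epsilon (IsPhase B)

/-- The hardness `B_θ = (1 - θ) a + θ b`. -/
def hardness (a b : ℝ) (θ : ℝ → ℝ) : ℝ → ℝ := fun t => (1 - θ t) * a + θ t * b

/-- Compliance plus cost of hard material: `J[K, θ] = -∫ (1 - t) sin K + c ∫ θ`. -/
def cost (c : ℝ) (K θ : ℝ → ℝ) : ℝ :=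
  -(∫ t in (0 : ℝ)..1, (1 - t) * Real.sin (K t)) + c * ∫ t in (0 : ℝ)..1, θ t

/-- The reduced cost `θ ↦ J[K[B_θ], θ]`. -/
def reducedCost (a b c : ℝ) (θ : ℝ → ℝ) : ℝ := cost c (phase (hardness a b θ)) θ

/-- Representatives of the elements of `L^∞((0,1); [0,1])`. -/
def designs : Set (ℝ → ℝ) :=
  {θ | AEMeasurable θ (volume.restrict (Ioo (0 : ℝ) 1)) ∧
    ∀ᵐ t ∂(volume.restrict (Ioo (0 : ℝ) 1)), θ t ∈ Icc (0 : ℝ) 1}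

/-- An optimal design minimises the reduced cost over `L^∞((0,1); [0,1])`. -/
def IsOptimalDesign (a b c : ℝ) (θ : ℝ → ℝ) : Prop :=
  θ ∈ designs ∧ IsMinOn (reducedCost a b c) designs θ

end PlateDesign

end

/-! Reflecting and truncating angles into [-π/2, 0] is nonexpansive and does not increase the sine
(`fold`). So phases take values in [-π/2, 0], where the sine is convex. There the energy is
uniformly convex, minimisers exist, and perturbing the hardness by ε moves K' by O(ε) in L²
(`integral_sq_deriv_sub_le`). The change of compliance is therefore controlled to first order
through an adjoint state P with derivative q (`compliance_le`). That state minimises a quadratic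
energy, convex because -sin K ≥ 0. Optimality becomes a pointwise condition: θ = 0 where (b-a) K' q
+ c > 0, and θ = 1 where it is negative (`ae_sign_condition`).

The Euler-Lagrange equations make the fluxes m = B K' and p = B q differentiable after modification
on a null set, however rough B is. In terms of them the switching function is (b-a) m p / B² + c, so
the sign condition says exactly that B is the point of [a, b] closest to √G, where G = -(b-a) m p /
c (`clampSqrt_eq_of_sign`). This yields the continuous representative and reduces its shape to that
of G.

The core is that G strictly decreases wherever it is positive (`flux_mul_lt`). Here m is nonpositive
and nondecreasing, and p' = -(1-t)(cos K + sin K · P). If the bracket were nonpositive at a point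
where p > 0, then up to the next zero of p the state P would not decrease and K would not increase.
The bracket would stay nonpositive and p could not return to zero, contradicting p(1) = 0
(`source_pos`). As G(1) = 0, the points t₀ (unless it is 0) and t₁ are where G crosses b² and a².
Between them √G is not truncated, so (K, P, m, p) solves a system with smooth right-hand side, and
bootstrapping gives smoothness. -/

noncomputable section

namespace PlateDesign

/-! ### Primitives of square integrable functions -/

/-- Lebesgue measure on the unit interval. -/
abbrev unitVol : Measure ℝ := volume.restrict (Ioo (0 : ℝ) 1)

/-- The primitive, vanishing at `0`, of the restriction of `u` to the unit interval. -/
def prim (u : ℝ → ℝ) (t : ℝ) : ℝ := ∫ s in (0 : ℝ)..t, (Ioo (0 : ℝ) 1).indicator u s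

instance : IsProbabilityMeasure unitVol := ⟨by simp [unitVol]⟩

lemma intervalIntegral_unit (f : ℝ → ℝ) : ∫ t in (0 : ℝ)..1, f t = ∫ t, f t ∂unitVol := by
  rw [intervalIntegral.integral_of_le zero_le_one, integral_Ioc_eq_integral_Ioo]

lemma ae_unitVol_mem : ∀ᵐ t ∂unitVol, t ∈ Ioo (0 : ℝ) 1 := ae_restrict_mem measurableSet_Ioo

lemma integrable_unitVol_of_continuousOn {f : ℝ → ℝ} (hf : ContinuousOn f (Icc 0 1)) :
    Integrable f unitVol :=
  (hf.integrableOn_compact isCompact_Icc).mono_set Ioo_subset_Icc_self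

lemma intervalIntegrable_indicator {u : ℝ → ℝ} (hu : Integrable u unitVol) (x y : ℝ) :
    IntervalIntegrable ((Ioo (0 : ℝ) 1).indicator u) volume x y :=
  ((integrable_indicator_iff measurableSet_Ioo).2 hu).intervalIntegrable

lemma continuous_prim {u : ℝ → ℝ} (hu : Integrable u unitVol) : Continuous (prim u) :=
  intervalIntegral.continuous_primitive (intervalIntegrable_indicator hu) 0

@[simp] lemma prim_zero_right (u : ℝ → ℝ) : prim u 0 = 0 := by simp [prim]

lemma prim_eq_integral (u : ℝ → ℝ) {t : ℝ} (ht : t ∈ Icc (0 : ℝ) 1) :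
    prim u t = ∫ s in (0 : ℝ)..t, u s := by
  unfold prim
  rw [intervalIntegral.integral_of_le ht.1, intervalIntegral.integral_of_le ht.1,
    integral_Ioc_eq_integral_Ioo, integral_Ioc_eq_integral_Ioo]
  refine setIntegral_congr_fun measurableSet_Ioo fun s hs => ?_
  have hs' : s ∈ Ioo (0 : ℝ) 1 := ⟨hs.1, hs.2.trans_le ht.2⟩
  exact indicator_of_mem hs' u

lemma prim_congr {u v : ℝ → ℝ} (h : u =ᵐ[unitVol] v) : prim u = prim v := by
  funext t
  have h' : (Ioo (0 : ℝ) 1).indicator u =ᵐ[volume] (Ioo (0 : ℝ) 1).indicator v :=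
    by
    filter_upwards [(ae_restrict_iff' measurableSet_Ioo).1 h] with x hx
    by_cases hs : x ∈ Ioo (0 : ℝ) 1
    · simp [hs, hx hs]
    · simp [hs]
  exact intervalIntegral.integral_congr_ae (h'.mono fun x hx _ => hx)

lemma prim_add {u v : ℝ → ℝ} (hu : Integrable u unitVol) (hv : Integrable v unitVol) (t : ℝ) :
    prim (fun s => u s + v s) t = prim u t + prim v t := by
  unfold prim
  rw [← intervalIntegral.integral_add (intervalIntegrable_indicator hu 0 t)
    (intervalIntegrable_indicator hv 0 t)]
  refine intervalIntegral.integral_congr fun s _ => ?_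
  by_cases hs : s ∈ Ioo (0 : ℝ) 1 <;> simp [hs]

lemma prim_const_mul (r : ℝ) (u : ℝ → ℝ) (t : ℝ) :
    prim (fun s => r * u s) t = r * prim u t := by
  unfold prim
  rw [← intervalIntegral.integral_const_mul]
  refine intervalIntegral.integral_congr fun s _ => ?_
  by_cases hs : s ∈ Ioo (0 : ℝ) 1 <;> simp [hs]

lemma prim_sub {u v : ℝ → ℝ} (hu : Integrable u unitVol) (hv : Integrable v unitVol) (t : ℝ) :
    prim (fun s => u s - v s) t = prim u t - prim v t := by
  have h : (fun s => u s - v s) = fun s => u s + (-1) * v s := by funext s; ring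
  rw [h, prim_add hu (hv.const_mul _), prim_const_mul]
  ring

lemma abs_prim_le {u : ℝ → ℝ} (hu : Integrable u unitVol) (t : ℝ) :
    |prim u t| ≤ ∫ s, |u s| ∂unitVol := by
  have hi := (integrable_indicator_iff measurableSet_Ioo).2 hu
  calc ‖prim u t‖ ≤ ∫ s in uIoc 0 t, ‖(Ioo (0 : ℝ) 1).indicator u s‖ :=
        intervalIntegral.norm_integral_le_integral_norm_uIoc
    _ ≤ ∫ s, ‖(Ioo (0 : ℝ) 1).indicator u s‖ :=
        setIntegral_le_integral hi.norm (Filter.Eventually.of_forall fun _ => norm_nonneg _)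
    _ = ∫ s, |u s| ∂unitVol := by
        rw [← integral_indicator measurableSet_Ioo]
        refine integral_congr_ae (Filter.Eventually.of_forall fun s => ?_)
        by_cases hs : s ∈ Ioo (0 : ℝ) 1 <;> simp [hs]

lemma integrable_of_memLp_two {u : ℝ → ℝ} (hu : MemLp u 2 unitVol) : Integrable u unitVol :=
  hu.integrable one_le_two

lemma sq_prim_le {u : ℝ → ℝ} (hu : MemLp u 2 unitVol) (t : ℝ) :
    prim u t ^ 2 ≤ ∫ s, u s ^ 2 ∂unitVol := by
  have hi := integrable_of_memLp_two hu
  set M := ∫ s, |u s| ∂unitVol with hM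
  -- Cauchy-Schwarz in the form of a nonnegative variance: the integrand is (|u| - M)² with M the
  -- mean of |u|.
  have h1 : 0 ≤ ∫ s, (u s ^ 2 - 2 * M * |u s| + M ^ 2) ∂unitVol :=
    integral_nonneg fun s => by
      change 0 ≤ u s ^ 2 - 2 * M * |u s| + M ^ 2
      nlinarith [sq_nonneg (|u s| - M), sq_abs (u s)]
  have h2 : ∫ s, (u s ^ 2 - 2 * M * |u s| + M ^ 2) ∂unitVol
      = ∫ s, u s ^ 2 ∂unitVol - 2 * M * M + M ^ 2 := by
    have e : Integrable (fun s => u s ^ 2 - 2 * M * |u s|) unitVol :=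
      hu.integrable_sq.sub (hi.abs.const_mul _)
    rw [integral_add e (integrable_const _),
      integral_sub hu.integrable_sq (hi.abs.const_mul _), integral_const_mul, ← hM]
    simp
  have h3 : |prim u t| ≤ M := abs_prim_le hi t
  have h4 : prim u t ^ 2 ≤ M ^ 2 := by
    rw [← sq_abs (prim u t)]; gcongr
  nlinarith

lemma ae_deriv_prim {u : ℝ → ℝ} (hu : Integrable u unitVol) :
    deriv (prim u) =ᵐ[unitVol] u := by
  have h := LocallyIntegrable.ae_hasDerivAt_integral
    ((integrable_indicator_iff measurableSet_Ioo).2 hu).locallyIntegrable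
  filter_upwards [ae_restrict_of_ae h, ae_unitVol_mem] with t ht ht'
  rw [← indicator_of_mem ht' u]
  exact (ht 0).deriv

lemma prim_mem_W12l {u : ℝ → ℝ} (hu : MemLp u 2 unitVol) : prim u ∈ W12l := by
  have hi := integrable_of_memLp_two hu
  refine ⟨?_, (memLp_congr_ae (ae_deriv_prim hi)).2 hu, prim_zero_right u⟩
  exact (intervalIntegrable_indicator hi 0 1).absolutelyContinuousOnInterval_intervalIntegral
    (by simp)

/-- Together with `prim_mem_W12l` this trades a state for its derivative, so that the variational
problems can be posed on all of L². -/
lemma eq_prim_deriv {K : ℝ → ℝ} (hK : K ∈ W12l) {t : ℝ} (ht : t ∈ Icc (0 : ℝ) 1) :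
    K t = prim (deriv K) t := by
  have h := (hK.1.mono (c := 0) (d := t) (by
    rw [uIcc_of_le ht.1, uIcc_of_le zero_le_one]
    exact Icc_subset_Icc_right ht.2)).integral_deriv_eq_sub
  rw [prim_eq_integral _ ht, h, hK.2.2, sub_zero]

/-- Integration by parts against a primitive. -/
lemma integral_mul_prim {ψ φ : ℝ → ℝ} (hψ : Continuous ψ) (hφ : Integrable φ unitVol) :
    ∫ t, ψ t * prim φ t ∂unitVol = ∫ t, (∫ s in t..1, ψ s) * φ t ∂unitVol := by
  have hd : ∀ t, HasDerivAt (fun t => ∫ s in t..1, ψ s) (-ψ t) t := fun t =>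
    intervalIntegral.integral_hasDerivAt_left (hψ.intervalIntegrable _ _)
      (hψ.stronglyMeasurableAtFilter _ _) hψ.continuousAt
  have hac : AbsolutelyContinuousOnInterval (fun t => ∫ s in t..1, ψ s) 0 1 := by
    refine ContDiffOn.absolutelyContinuousOnInterval (ContDiff.contDiffOn ?_)
    rw [contDiff_one_iff_deriv]
    refine ⟨fun t => (hd t).differentiableAt, ?_⟩
    rw [funext fun t => (hd t).deriv]
    exact hψ.neg
  have hac' : AbsolutelyContinuousOnInterval (prim φ) 0 1 :=
    (intervalIntegrable_indicator hφ 0 1).absolutelyContinuousOnInterval_intervalIntegral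
      (by simp)
  have h := hac.integral_mul_deriv_eq_deriv_mul hac'
  rw [intervalIntegral_unit, intervalIntegral_unit] at h
  simp only [intervalIntegral.integral_same, zero_mul, prim_zero_right, mul_zero, sub_self,
    zero_sub, (hd _).deriv, neg_mul, intervalIntegral.integral_neg, neg_neg] at h
  rw [← intervalIntegral_unit, ← h]
  refine integral_congr_ae ?_
  filter_upwards [ae_deriv_prim hφ] with t ht
  rw [ht]

/-! ### Energies with bounded measurable coefficient: expansion, Euler-Lagrange equation, convexity
-/

/-- `B` is a measurable coefficient on the unit interval with values in `[a, b]`. -/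
structure IsCoeff (a b : ℝ) (B : ℝ → ℝ) : Prop where
  aemeasurable : AEMeasurable B unitVol
  mem_Icc : ∀ᵐ t ∂unitVol, B t ∈ Icc a b

/-- `Φ'` is a derivative of `Φ` in the second variable, with a quadratic Taylor remainder. -/
structure IsPotential (Φ Φ' : ℝ → ℝ → ℝ) : Prop where
  continuous : Continuous fun p : ℝ × ℝ => Φ p.1 p.2
  continuous_deriv : Continuous fun p : ℝ × ℝ => Φ' p.1 p.2
  taylor : ∀ t ∈ Ioo (0 : ℝ) 1, ∀ x h, |Φ t (x + h) - Φ t x - Φ' t x * h| ≤ h ^ 2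

/-- The functional `½ ∫ B u² + ∫ Φ(t, ∫₀ᵗ u)`. -/
def energy (B : ℝ → ℝ) (Φ : ℝ → ℝ → ℝ) (u : ℝ → ℝ) : ℝ :=
  (1 / 2) * (∫ t, B t * u t ^ 2 ∂unitVol) + ∫ t, Φ t (prim u t) ∂unitVol

/-- The first variation of `energy` at `u` in direction `h`. -/
def firstVar (B : ℝ → ℝ) (Φ' : ℝ → ℝ → ℝ) (u h : ℝ → ℝ) : ℝ :=
  (∫ t, B t * (u t * h t) ∂unitVol) + ∫ t, Φ' t (prim u t) * prim h t ∂unitVol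

lemma energy_congr {B : ℝ → ℝ} {Φ : ℝ → ℝ → ℝ} {u v : ℝ → ℝ} (h : u =ᵐ[unitVol] v) :
    energy B Φ u = energy B Φ v := by
  unfold energy
  rw [prim_congr h]
  congr 2
  exact integral_congr_ae (h.mono fun t ht => by simp only [ht])

section

variable {a b : ℝ} {B : ℝ → ℝ} {Φ Φ' : ℝ → ℝ → ℝ} {u v h : ℝ → ℝ}

lemma IsCoeff.abs_le (hB : IsCoeff a b B) (ha : 0 < a) : ∀ᵐ t ∂unitVol, ‖B t‖ ≤ b :=
  hB.mem_Icc.mono fun t ht => by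
    rw [Real.norm_eq_abs, abs_of_nonneg (ha.le.trans ht.1)]; exact ht.2

lemma IsCoeff.integrable_mul (hB : IsCoeff a b B) (ha : 0 < a) (hu : Integrable u unitVol) :
    Integrable (fun t => B t * u t) unitVol :=
  hu.bdd_mul hB.aemeasurable.aestronglyMeasurable (hB.abs_le ha)

lemma integrable_mul_of_memLp (hu : MemLp u 2 unitVol) (hv : MemLp v 2 unitVol) :
    Integrable (fun t => u t * v t) unitVol := MemLp.integrable_mul hu hv

lemma integrable_comp_prim {Ψ : ℝ → ℝ → ℝ} (hΨ : Continuous fun p : ℝ × ℝ => Ψ p.1 p.2)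
    (hu : Integrable u unitVol) : Integrable (fun t => Ψ t (prim u t)) unitVol :=
  integrable_unitVol_of_continuousOn
    (hΨ.comp (continuous_id.prodMk (continuous_prim hu))).continuousOn

lemma integrable_comp_prim_mul {Ψ : ℝ → ℝ → ℝ} (hΨ : Continuous fun p : ℝ × ℝ => Ψ p.1 p.2)
    (hu : Integrable u unitVol) (hv : Integrable v unitVol) :
    Integrable (fun t => Ψ t (prim u t) * prim v t) unitVol :=
  integrable_unitVol_of_continuousOn
    ((hΨ.comp (continuous_id.prodMk (continuous_prim hu))).mul (continuous_prim hv)).continuousOn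

lemma integrable_sq_prim (hu : Integrable u unitVol) :
    Integrable (fun t => prim u t ^ 2) unitVol :=
  integrable_unitVol_of_continuousOn ((continuous_prim hu).pow 2).continuousOn

lemma integral_sq_prim_le (hu : MemLp u 2 unitVol) :
    ∫ t, prim u t ^ 2 ∂unitVol ≤ ∫ t, u t ^ 2 ∂unitVol := by
  have := integral_mono (integrable_sq_prim (integrable_of_memLp_two hu))
    (integrable_const (μ := unitVol) (∫ t, u t ^ 2 ∂unitVol)) fun t => sq_prim_le hu t
  simpa using this

/-- Serves twice: for the Euler-Lagrange equation and for the continuity of the energy in L². In the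
constant, b/2 comes from the quadratic part and 1 from the Taylor remainder of the potential via
`integral_sq_prim_le`. -/
lemma abs_energy_add_sub_le (hB : IsCoeff a b B) (ha : 0 < a) (hΦ : IsPotential Φ Φ')
    (hu : MemLp u 2 unitVol) (hh : MemLp h 2 unitVol) :
    |energy B Φ (fun t => u t + h t) - energy B Φ u - firstVar B Φ' u h|
      ≤ (b / 2 + 1) * ∫ t, h t ^ 2 ∂unitVol := by
  have iu := integrable_of_memLp_two hu
  have ih := integrable_of_memLp_two hh
  have hv : MemLp (fun t => u t + h t) 2 unitVol := hu.add hh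
  have i1 := hB.integrable_mul ha hv.integrable_sq
  have i2 := hB.integrable_mul ha hu.integrable_sq
  have i3 := hB.integrable_mul ha (integrable_mul_of_memLp hu hh)
  have i4 := integrable_comp_prim hΦ.continuous (integrable_of_memLp_two hv)
  have i5 := integrable_comp_prim hΦ.continuous iu
  have i6 := integrable_comp_prim_mul hΦ.continuous_deriv iu ih
  have e : energy B Φ (fun t => u t + h t) - energy B Φ u - firstVar B Φ' u h =
      ∫ t, ((1 / 2 * (B t * (u t + h t) ^ 2) - 1 / 2 * (B t * u t ^ 2) - B t * (u t * h t)) +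
        (Φ t (prim (fun t => u t + h t) t) - Φ t (prim u t) - Φ' t (prim u t) * prim h t))
        ∂unitVol := by
    have j1 : Integrable (fun t => 1 / 2 * (B t * (u t + h t) ^ 2) - 1 / 2 * (B t * u t ^ 2))
      unitVol := (i1.const_mul _).sub (i2.const_mul _)
    have j2 : Integrable (fun t => Φ t (prim (fun t => u t + h t) t) - Φ t (prim u t))
      unitVol := i4.sub i5
    have j3 : Integrable (fun t => 1 / 2 * (B t * (u t + h t) ^ 2) - 1 / 2 * (B t * u t ^ 2)
      - B t * (u t * h t)) unitVol := j1.sub i3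
    have j4 : Integrable (fun t => Φ t (prim (fun t => u t + h t) t) - Φ t (prim u t)
      - Φ' t (prim u t) * prim h t) unitVol := j2.sub i6
    rw [integral_add j3 j4, integral_sub j1 i3, integral_sub j2 i6,
      integral_sub (i1.const_mul _) (i2.const_mul _), integral_sub i4 i5, integral_const_mul,
      integral_const_mul]
    unfold energy firstVar
    ring
  have ib : Integrable (fun t => b / 2 * h t ^ 2 + prim h t ^ 2) unitVol :=
    (hh.integrable_sq.const_mul _).add (integrable_sq_prim ih)
  rw [e]
  calc _ ≤ ∫ t, (b / 2 * h t ^ 2 + prim h t ^ 2) ∂unitVol := by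
        rw [← Real.norm_eq_abs]
        refine norm_integral_le_of_norm_le ib ?_
        filter_upwards [hB.mem_Icc, ae_unitVol_mem] with t ht ht'
        rw [Real.norm_eq_abs]
        refine (abs_add_le _ _).trans (add_le_add ?_ ?_)
        · rw [show 1 / 2 * (B t * (u t + h t) ^ 2) - 1 / 2 * (B t * u t ^ 2) - B t * (u t * h t)
            = B t / 2 * h t ^ 2 by ring, abs_of_nonneg (by
              have := ha.le.trans ht.1; positivity)]
          have := ht.2
          gcongr
        · rw [prim_add iu ih]
          exact hΦ.taylor t ht' _ _
    _ = b / 2 * (∫ t, h t ^ 2 ∂unitVol) + ∫ t, prim h t ^ 2 ∂unitVol := by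
        rw [integral_add (hh.integrable_sq.const_mul _) (integrable_sq_prim ih),
          integral_const_mul]
    _ ≤ _ := by linarith [integral_sq_prim_le hh]

lemma firstVar_const_mul (r : ℝ) : firstVar B Φ' u (fun t => r * h t) = r * firstVar B Φ' u h := by
  unfold firstVar
  rw [mul_add, ← integral_const_mul, ← integral_const_mul]
  congr 1
  · exact integral_congr_ae (Filter.Eventually.of_forall fun t => by ring)
  · refine integral_congr_ae (Filter.Eventually.of_forall fun t => ?_)
    simp only [prim_const_mul]
    ring

lemma nonneg_of_forall_linear_add_sq {L C : ℝ}
    (hL : ∀ ε ∈ Ioc (0 : ℝ) 1, 0 ≤ ε * L + C * ε ^ 2) : 0 ≤ L := by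
  by_contra! hneg
  have hD : 0 < |C| + |L| + 1 := by positivity
  -- In the denominator, |L| keeps ε at most 1, |C| lets the linear term dominate, and 1 excludes
  -- division by zero.
  set ε := -L / (|C| + |L| + 1) with hε
  have h0 : 0 < ε := div_pos (by linarith) hD
  have h1 : ε ≤ 1 := by
    rw [hε, div_le_one hD, ← abs_of_neg hneg]
    linarith [abs_nonneg C]
  have h2 := hL ε ⟨h0, h1⟩
  have h3 : 0 ≤ L + C * ε := by
    by_contra! h
    nlinarith
  have h4 : ε * (|C| + |L| + 1) = -L := by rw [hε]; field_simp
  nlinarith [le_abs_self C, abs_nonneg L]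

/-- The Euler-Lagrange equation of a global minimiser. -/
lemma firstVar_eq_zero (hB : IsCoeff a b B) (ha : 0 < a) (hΦ : IsPotential Φ Φ')
    (hu : MemLp u 2 unitVol)
    (hmin : ∀ v, MemLp v 2 unitVol → energy B Φ u ≤ energy B Φ v)
    (hh : MemLp h 2 unitVol) : firstVar B Φ' u h = 0 := by
  have key : ∀ h, MemLp h 2 unitVol → 0 ≤ firstVar B Φ' u h := by
    intro h hh
    refine nonneg_of_forall_linear_add_sq
      (C := (b / 2 + 1) * ∫ t, h t ^ 2 ∂unitVol) fun ε _ => ?_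
    have hεh : MemLp (fun t => ε * h t) 2 unitVol := hh.const_mul ε
    have h1 := (abs_le.1 (abs_energy_add_sub_le hB ha hΦ hu hεh)).2
    have h2 := hmin _ (hu.add hεh)
    have h3 : ∫ t, (ε * h t) ^ 2 ∂unitVol = ε ^ 2 * ∫ t, h t ^ 2 ∂unitVol := by
      simp only [mul_pow]; rw [integral_const_mul]
    rw [firstVar_const_mul, h3] at h1
    have h4 : energy B Φ u ≤ energy B Φ (fun t => u t + ε * h t) := h2
    linarith
  have h1 := key h hh
  have h2 := key (fun t => (-1) * h t) (hh.const_mul _)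
  rw [firstVar_const_mul] at h2
  linarith

lemma integral_abs_mul_le_sqrt (hu : MemLp u 2 unitVol) (hv : MemLp v 2 unitVol) :
    ∫ t, |u t| * |v t| ∂unitVol
      ≤ √(∫ t, u t ^ 2 ∂unitVol) * √(∫ t, v t ^ 2 ∂unitVol) := by
  have := integral_mul_le_Lp_mul_Lq_of_nonneg (μ := unitVol) Real.HolderConjugate.two_two
    (f := fun t => |u t|) (g := fun t => |v t|)
    (Filter.Eventually.of_forall fun _ => abs_nonneg _)
    (Filter.Eventually.of_forall fun _ => abs_nonneg _)
    (by rw [show ENNReal.ofReal 2 = 2 by simp]; exact hu.abs)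
    (by rw [show ENNReal.ofReal 2 = 2 by simp]; exact hv.abs)
  simpa [Real.sqrt_eq_rpow] using this

lemma abs_firstVar_le (hB : IsCoeff a b B) (ha : 0 < a) (hΦ : IsPotential Φ Φ')
    (hu : MemLp u 2 unitVol) :
    ∃ M, ∀ h, MemLp h 2 unitVol → |firstVar B Φ' u h| ≤ M * √(∫ t, h t ^ 2 ∂unitVol) := by
  have iu := integrable_of_memLp_two hu
  have hc : Continuous fun t => Φ' t (prim u t) :=
    hΦ.continuous_deriv.comp (continuous_id.prodMk (continuous_prim iu))
  obtain ⟨C, hC⟩ := isCompact_Icc.exists_bound_of_continuousOn (hc.continuousOn (s := Icc 0 1))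
  refine ⟨b * √(∫ t, u t ^ 2 ∂unitVol) + C, fun h hh => ?_⟩
  have hC0 : 0 ≤ C := (norm_nonneg _).trans (hC 0 (by simp))
  have hb0 : 0 ≤ b := by
    obtain ⟨t, ht⟩ := hB.mem_Icc.exists
    linarith [ht.1, ht.2]
  unfold firstVar
  rw [add_mul]
  refine (abs_add_le _ _).trans (add_le_add ?_ ?_)
  · rw [mul_assoc]
    refine le_trans ?_ (mul_le_mul_of_nonneg_left (integral_abs_mul_le_sqrt hu hh) hb0)
    rw [← integral_const_mul, ← Real.norm_eq_abs]
    refine norm_integral_le_of_norm_le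
      ((integrable_mul_of_memLp hu.abs hh.abs).const_mul b) ?_
    filter_upwards [hB.abs_le ha] with t ht
    rw [norm_mul, norm_mul]
    exact mul_le_mul_of_nonneg_right ht (by positivity)
  · have : ∀ᵐ t ∂unitVol, ‖Φ' t (prim u t) * prim h t‖ ≤ C * √(∫ t, h t ^ 2 ∂unitVol) := by
      filter_upwards [ae_unitVol_mem] with t ht
      rw [norm_mul]
      refine mul_le_mul (hC t (Ioo_subset_Icc_self ht)) ?_ (norm_nonneg _) hC0
      exact Real.abs_le_sqrt (sq_prim_le hh t)
    simpa using norm_integral_le_of_norm_le_const this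

/-- The parallelogram identity and B ≥ a supply the quadratic gain, with 1/2 · a · 1/4 = a/8; the
potential only has to be convex on the range of the primitives. -/
lemma energy_midpoint_le {I : Set ℝ} (hB : IsCoeff a b B) (ha : 0 < a) (hΦ : IsPotential Φ Φ')
    (hconv : ∀ t ∈ Ioo (0 : ℝ) 1, ConvexOn ℝ I (Φ t))
    (hu : MemLp u 2 unitVol) (hv : MemLp v 2 unitVol)
    (hu' : ∀ t ∈ Icc (0 : ℝ) 1, prim u t ∈ I) (hv' : ∀ t ∈ Icc (0 : ℝ) 1, prim v t ∈ I) :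
    energy B Φ (fun t => 1 / 2 * (u t + v t)) ≤ (energy B Φ u + energy B Φ v) / 2
      - a / 8 * ∫ t, (u t - v t) ^ 2 ∂unitVol := by
  have iu := integrable_of_memLp_two hu
  have iv := integrable_of_memLp_two hv
  have hw : MemLp (fun t => 1 / 2 * (u t + v t)) 2 unitVol := (hu.add hv).const_mul _
  have hd : MemLp (fun t => u t - v t) 2 unitVol := hu.sub hv
  have i1 := hB.integrable_mul ha hw.integrable_sq
  have i2 := hB.integrable_mul ha hu.integrable_sq
  have i3 := hB.integrable_mul ha hv.integrable_sq
  have i4 := integrable_comp_prim hΦ.continuous (integrable_of_memLp_two hw)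
  have i5 := integrable_comp_prim hΦ.continuous iu
  have i6 := integrable_comp_prim hΦ.continuous iv
  have h1 : ∫ t, B t * (1 / 2 * (u t + v t)) ^ 2 ∂unitVol ≤
      1 / 2 * (∫ t, B t * u t ^ 2 ∂unitVol) + 1 / 2 * (∫ t, B t * v t ^ 2 ∂unitVol)
        - a / 4 * ∫ t, (u t - v t) ^ 2 ∂unitVol := by
    have j : Integrable (fun t => 1 / 2 * (B t * u t ^ 2) + 1 / 2 * (B t * v t ^ 2)) unitVol :=
      (i2.const_mul _).add (i3.const_mul _)
    rw [← integral_const_mul, ← integral_const_mul, ← integral_const_mul,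
      ← integral_add (i2.const_mul _) (i3.const_mul _),
      ← integral_sub j (hd.integrable_sq.const_mul _)]
    refine integral_mono_ae i1 (j.sub (hd.integrable_sq.const_mul _)) ?_
    filter_upwards [hB.mem_Icc] with t ht
    have := mul_nonneg (sub_nonneg.2 ht.1) (sq_nonneg (u t - v t))
    change B t * (1 / 2 * (u t + v t)) ^ 2 ≤ 1 / 2 * (B t * u t ^ 2) + 1 / 2 * (B t * v t ^ 2)
      - a / 4 * (u t - v t) ^ 2
    nlinarith
  have h2 : ∫ t, Φ t (prim (fun t => 1 / 2 * (u t + v t)) t) ∂unitVol ≤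
      1 / 2 * (∫ t, Φ t (prim u t) ∂unitVol) + 1 / 2 * ∫ t, Φ t (prim v t) ∂unitVol := by
    rw [← integral_const_mul, ← integral_const_mul,
      ← integral_add (i5.const_mul _) (i6.const_mul _)]
    refine integral_mono_ae i4 ((i5.const_mul _).add (i6.const_mul _)) ?_
    filter_upwards [ae_unitVol_mem] with t ht
    have ht' := Ioo_subset_Icc_self ht
    have hc := hconv t ht
    have := hc.2 (hu' t ht') (hv' t ht')
      (show (0 : ℝ) ≤ 1 / 2 by norm_num) (show (0 : ℝ) ≤ 1 / 2 by norm_num) (by norm_num)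
    rw [prim_const_mul, prim_add iu iv, mul_add]
    exact this
  unfold energy
  linarith

/-- The potential costs at most ∫|u|, because the primitive is bounded by it, and completing the
square gives a u²/2 - |u| ≥ -1/(2a). -/
lemma energy_ge (hB : IsCoeff a b B) (ha : 0 < a) (hΦ : IsPotential Φ Φ')
    (hlow : ∀ t ∈ Ioo (0 : ℝ) 1, ∀ x, -|x| ≤ Φ t x) (hu : MemLp u 2 unitVol) :
    -(1 / (2 * a)) ≤ energy B Φ u := by
  have iu := integrable_of_memLp_two hu
  have i2 := hB.integrable_mul ha hu.integrable_sq
  have i5 := integrable_comp_prim hΦ.continuous iu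
  have h1 : -∫ t, |u t| ∂unitVol ≤ ∫ t, Φ t (prim u t) ∂unitVol := by
    have := integral_mono_ae (integrable_const (μ := unitVol) (-∫ t, |u t| ∂unitVol)) i5 (by
      filter_upwards [ae_unitVol_mem] with t ht
      linarith [hlow t ht (prim u t), abs_prim_le iu t])
    simpa using this
  have h2 : ∫ t, (|u t| - 1 / (2 * a)) ∂unitVol ≤ ∫ t, 1 / 2 * (B t * u t ^ 2) ∂unitVol := by
    refine integral_mono_ae (iu.abs.sub (integrable_const _)) (i2.const_mul _) ?_
    filter_upwards [hB.mem_Icc] with t ht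
    have h3 := mul_nonneg (sub_nonneg.2 ht.1) (sq_nonneg (u t))
    have h4 : 1 / 2 * (a * u t ^ 2) - |u t| + 1 / (2 * a) = (a * |u t| - 1) ^ 2 / (2 * a) := by
      rw [← sq_abs (u t)]; field_simp; ring
    have h5 : 0 ≤ (a * |u t| - 1) ^ 2 / (2 * a) := by positivity
    linarith
  rw [integral_sub iu.abs (integrable_const _), integral_const_mul] at h2
  simp only [integral_const, probReal_univ, smul_eq_mul, one_mul] at h2
  unfold energy
  linarith

end

/-! ### Existence of minimisers -/

/-- A continuous function that is bounded below and uniformly midpoint convex on a closed subset of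
a complete space attains its minimum there. -/
lemma exists_isMinOn_of_midpoint {E : Type*} [NormedAddCommGroup E] [NormedSpace ℝ E]
    [CompleteSpace E] {C : Set E} {F : E → ℝ} {k m : ℝ} (hk : 0 < k) (hC : IsClosed C)
    (hne : C.Nonempty) (hF : Continuous F) (hm : ∀ u ∈ C, m ≤ F u)
    (hmid : ∀ u ∈ C, ∀ v ∈ C, ∃ w ∈ C, F w ≤ (F u + F v) / 2 - k * ‖u - v‖ ^ 2) :
    ∃ u ∈ C, IsMinOn F C u := by
  set i := sInf (F '' C) with hi
  have hbdd : BddBelow (F '' C) := ⟨m, by rintro _ ⟨u, hu, rfl⟩; exact hm u hu⟩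
  have hle : ∀ u ∈ C, i ≤ F u := fun u hu => csInf_le hbdd ⟨u, hu, rfl⟩
  -- The gap to the infimum is chosen so that the midpoint inequality gives distance at most 1/(N+1)
  -- between later terms: the minimising sequence is Cauchy, and no weak compactness is needed.
  have hex : ∀ n : ℕ, ∃ u ∈ C, F u < i + k * (1 / ((n : ℝ) + 1)) ^ 2 := fun n => by
    obtain ⟨_, ⟨u, hu, rfl⟩, hlt⟩ := exists_lt_of_csInf_lt (hne.image F)
      (show sInf (F '' C) < i + k * (1 / ((n : ℝ) + 1)) ^ 2 by
        rw [← hi]; have : 0 < k * (1 / ((n : ℝ) + 1)) ^ 2 := by positivity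
        linarith)
    exact ⟨u, hu, hlt⟩
  choose U hUC hU using hex
  have hdist : ∀ N n l : ℕ, N ≤ n → N ≤ l → dist (U n) (U l) ≤ 1 / ((N : ℝ) + 1) := by
    intro N n l hn hl
    obtain ⟨w, hw, hFw⟩ := hmid _ (hUC n) _ (hUC l)
    have h1 : (1 / ((n : ℝ) + 1)) ^ 2 ≤ (1 / ((N : ℝ) + 1)) ^ 2 := by gcongr
    have h2 : (1 / ((l : ℝ) + 1)) ^ 2 ≤ (1 / ((N : ℝ) + 1)) ^ 2 := by gcongr
    have h3 : k * ‖U n - U l‖ ^ 2 ≤ k * (1 / ((N : ℝ) + 1)) ^ 2 := by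
      nlinarith [hle w hw, hU n, hU l]
    have h4 : ‖U n - U l‖ ^ 2 ≤ (1 / ((N : ℝ) + 1)) ^ 2 := le_of_mul_le_mul_left h3 hk
    rw [dist_eq_norm]
    exact le_of_sq_le_sq h4 (by positivity)
  have hcau : CauchySeq U := cauchySeq_of_le_tendsto_0 (fun N : ℕ => 1 / ((N : ℝ) + 1))
    (fun n l N hn hl => hdist N n l hn hl) tendsto_one_div_add_atTop_nhds_zero_nat
  obtain ⟨u, hu⟩ := cauchySeq_tendsto_of_complete hcau
  have huC : u ∈ C := hC.mem_of_tendsto hu (Filter.Eventually.of_forall hUC)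
  refine ⟨u, huC, fun v hv => ?_⟩
  have hlim : Filter.Tendsto (fun n : ℕ => i + k * (1 / ((n : ℝ) + 1)) ^ 2) Filter.atTop
      (nhds (i + k * 0 ^ 2)) :=
    ((tendsto_one_div_add_atTop_nhds_zero_nat.pow 2).const_mul k).const_add i
  have : F u ≤ i + k * 0 ^ 2 :=
    le_of_tendsto_of_tendsto' ((hF.tendsto u).comp hu) hlim fun n => (hU n).le
  have h5 := hle v hv
  change F u ≤ F v
  linarith [show k * (0 : ℝ) ^ 2 = 0 by simp]

lemma norm_sq_Lp (u : Lp ℝ 2 unitVol) : ‖u‖ ^ 2 = ∫ t, u t ^ 2 ∂unitVol := by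
  rw [← real_inner_self_eq_norm_sq, L2.inner_def]
  refine integral_congr_ae (Filter.Eventually.of_forall fun t => ?_)
  simp [sq]

/-- Existence of minimisers of `energy` under a convex constraint on the primitive. -/
lemma exists_minimiser {a b : ℝ} {B : ℝ → ℝ} {Φ Φ' : ℝ → ℝ → ℝ} {I : Set ℝ}
    (hB : IsCoeff a b B) (ha : 0 < a) (hΦ : IsPotential Φ Φ')
    (hI : IsClosed I) (h0 : (0 : ℝ) ∈ I)
    (hconv : ∀ t ∈ Ioo (0 : ℝ) 1, ConvexOn ℝ I (Φ t))
    (hlow : ∀ t ∈ Ioo (0 : ℝ) 1, ∀ x, -|x| ≤ Φ t x) :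
    ∃ u, MemLp u 2 unitVol ∧ (∀ t ∈ Icc (0 : ℝ) 1, prim u t ∈ I) ∧
      ∀ v, MemLp v 2 unitVol → (∀ t ∈ Icc (0 : ℝ) 1, prim v t ∈ I) →
        energy B Φ u ≤ energy B Φ v := by
  have hIc : Convex ℝ I := (hconv (1 / 2) (by constructor <;> norm_num)).1
  let C : Set (Lp ℝ 2 unitVol) := {u | ∀ t ∈ Icc (0 : ℝ) 1, prim u t ∈ I}
  let F : Lp ℝ 2 unitVol → ℝ := fun u => energy B Φ u
  have hsub : ∀ u v : Lp ℝ 2 unitVol, ((u - v : Lp ℝ 2 unitVol) : ℝ → ℝ) =ᵐ[unitVol]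
      fun t => u t - v t := fun u v => Lp.coeFn_sub u v
  -- Evaluating the primitive at a point is 1-Lipschitz on L², which makes the constraint set
  -- closed.
  have hprimc : ∀ t, Continuous fun u : Lp ℝ 2 unitVol => prim u t := by
    intro t
    refine (LipschitzWith.of_dist_le_mul (K := 1) fun u v => ?_).continuous
    rw [NNReal.coe_one, one_mul, Real.dist_eq, dist_eq_norm]
    rw [← prim_sub (integrable_of_memLp_two (Lp.memLp u)) (integrable_of_memLp_two (Lp.memLp v)),
      ← prim_congr (hsub u v)]
    refine abs_le_of_sq_le_sq ?_ (norm_nonneg _)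
    rw [norm_sq_Lp]
    exact sq_prim_le (Lp.memLp _) t
  have hCcl : IsClosed C := by
    have : C = ⋂ t ∈ Icc (0 : ℝ) 1, {u : Lp ℝ 2 unitVol | prim u t ∈ I} := by
      ext u; simp [C]
    rw [this]
    exact isClosed_biInter fun t _ => hI.preimage (hprimc t)
  have hFc : Continuous F := by
    rw [continuous_iff_continuousAt]
    intro u
    obtain ⟨M, hM⟩ := abs_firstVar_le hB ha hΦ (Lp.memLp u)
    have hbound : ∀ v : Lp ℝ 2 unitVol,
        dist (F v) (F u) ≤ M * ‖v - u‖ + (b / 2 + 1) * ‖v - u‖ ^ 2 := by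
      intro v
      have h1 := abs_energy_add_sub_le hB ha hΦ (Lp.memLp u) (Lp.memLp (v - u))
      have h2 := hM _ (Lp.memLp (v - u))
      rw [← norm_sq_Lp] at h1 h2
      rw [Real.sqrt_sq (norm_nonneg _)] at h2
      have h3 : energy B Φ (fun t => u t + (v - u : Lp ℝ 2 unitVol) t) = F v :=
        energy_congr ((hsub v u).mono fun t ht => by simp only [ht]; ring)
      rw [h3] at h1
      rw [Real.dist_eq]
      calc |F v - F u| = |(F v - energy B Φ u - firstVar B Φ' u (v - u : Lp ℝ 2 unitVol))
            + firstVar B Φ' u (v - u : Lp ℝ 2 unitVol)| := by congr 1; simp only [F]; ring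
        _ ≤ _ := (abs_add_le _ _).trans (by linarith)
    have hz : Filter.Tendsto (fun v : Lp ℝ 2 unitVol =>
        M * ‖v - u‖ + (b / 2 + 1) * ‖v - u‖ ^ 2) (nhds u) (nhds 0) := by
      have : Continuous fun v : Lp ℝ 2 unitVol =>
        M * ‖v - u‖ + (b / 2 + 1) * ‖v - u‖ ^ 2 := by fun_prop
      simpa using this.tendsto u
    exact tendsto_iff_dist_tendsto_zero.2 (squeeze_zero (fun _ => dist_nonneg) hbound hz)
  have hne : C.Nonempty := by
    refine ⟨0, fun t _ => ?_⟩
    have : prim ((0 : Lp ℝ 2 unitVol) : ℝ → ℝ) t = 0 := by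
      rw [prim_congr (Lp.coeFn_zero ℝ 2 unitVol)]
      simp [prim]
    rw [this]; exact h0
  obtain ⟨u, huC, humin⟩ := exists_isMinOn_of_midpoint (F := F) (C := C) (k := a / 8)
    (by positivity) hCcl hne hFc (fun u _ => energy_ge hB ha hΦ hlow (Lp.memLp u)) (by
      intro u hu v hv
      have hw : MemLp (fun t => 1 / 2 * (u t + v t)) 2 unitVol :=
        ((Lp.memLp u).add (Lp.memLp v)).const_mul _
      refine ⟨hw.toLp _, fun t ht => ?_, ?_⟩
      · rw [prim_congr hw.coeFn_toLp, prim_const_mul, prim_add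
          (integrable_of_memLp_two (Lp.memLp u)) (integrable_of_memLp_two (Lp.memLp v)), mul_add]
        exact hIc (hu t ht) (hv t ht) (by norm_num) (by norm_num) (by norm_num)
      · have h1 := energy_midpoint_le hB ha hΦ hconv (Lp.memLp u) (Lp.memLp v) hu hv
        rw [norm_sq_Lp, integral_congr_ae ((hsub u v).mono fun t ht =>
          show _ = (u t - v t) ^ 2 by simp only [ht])]
        simp only [F]
        rw [energy_congr hw.coeFn_toLp]
        exact h1)
  refine ⟨u, Lp.memLp u, huC, fun v hv hvI => ?_⟩
  have h1 : hv.toLp v ∈ C := fun t ht => by rw [prim_congr hv.coeFn_toLp]; exact hvI t ht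
  have h2 : F u ≤ F (hv.toLp v) := humin h1
  have h3 : F (hv.toLp v) = energy B Φ v := energy_congr hv.coeFn_toLp
  exact h2.trans h3.le

/-! ### Taylor bounds and the gravity potential -/

lemma abs_taylor_le_sq {f f' : ℝ → ℝ} (hf : ∀ x, HasDerivAt f (f' x) x)
    (hL : ∀ x y, |f' x - f' y| ≤ |x - y|) (x h : ℝ) :
    |f (x + h) - f x - f' x * h| ≤ h ^ 2 := by
  -- The mean value inequality is applied to f minus its linear part at x, whose derivative is at
  -- most |h| between x and x + h.
  have hg : ∀ y, HasDerivAt (fun y => f y - f' x * y) (f' y - f' x) y := fun y => by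
    have := (hf y).fun_sub ((hasDerivAt_id y).const_mul (f' x))
    simpa using this
  have := (convex_uIcc x (x + h)).norm_image_sub_le_of_norm_hasDerivWithin_le
    (C := |h|) (fun y _ => (hg y).hasDerivWithinAt) (fun y hy => by
      rw [Real.norm_eq_abs]
      refine (hL y x).trans ?_
      have := abs_sub_left_of_mem_uIcc hy
      simpa using this) left_mem_uIcc right_mem_uIcc
  rw [Real.norm_eq_abs, Real.norm_eq_abs, add_sub_cancel_left, ← sq, sq_abs] at this
  convert this using 2
  ring

lemma abs_cos_sub_cos_le (x y : ℝ) : |Real.cos x - Real.cos y| ≤ |x - y| := by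
  simpa [Real.dist_eq] using Real.lipschitzWith_cos.dist_le_mul x y

lemma abs_sin_sub_sin_le (x y : ℝ) : |Real.sin x - Real.sin y| ≤ |x - y| := by
  simpa [Real.dist_eq] using Real.lipschitzWith_sin.dist_le_mul x y

lemma abs_sin_taylor_le (x h : ℝ) :
    |Real.sin (x + h) - Real.sin x - Real.cos x * h| ≤ h ^ 2 :=
  abs_taylor_le_sq Real.hasDerivAt_sin abs_cos_sub_cos_le x h

lemma abs_cos_taylor_le (x h : ℝ) :
    |Real.cos (x + h) - Real.cos x + Real.sin x * h| ≤ h ^ 2 := by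
  have := abs_taylor_le_sq Real.hasDerivAt_cos
    (fun x y => by rw [neg_sub_neg, abs_sub_comm]; exact abs_sin_sub_sin_le x y) x h
  simpa using this

/-- The potential of the gravity force. -/
def gravity (t x : ℝ) : ℝ := (1 - t) * Real.sin x

/-- The derivative of `gravity` with respect to the angle. -/
def gravity' (t x : ℝ) : ℝ := (1 - t) * Real.cos x

lemma abs_one_sub_mul_le {t x y : ℝ} (ht : t ∈ Ioo (0 : ℝ) 1) (h : |x| ≤ y) :
    |(1 - t) * x| ≤ y := by
  rw [abs_mul, abs_of_pos (by linarith [ht.2])]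
  have := ht.1
  nlinarith [abs_nonneg x]

lemma isPotential_gravity : IsPotential gravity gravity' where
  continuous := by unfold gravity; fun_prop
  continuous_deriv := by unfold gravity'; fun_prop
  taylor t ht x h := by
    unfold gravity gravity'
    rw [show (1 - t) * Real.sin (x + h) - (1 - t) * Real.sin x - (1 - t) * Real.cos x * h
      = (1 - t) * (Real.sin (x + h) - Real.sin x - Real.cos x * h) by ring]
    exact abs_one_sub_mul_le ht (abs_sin_taylor_le x h)

lemma convexOn_sin : ConvexOn ℝ (Icc (-(Real.pi / 2)) 0) Real.sin := by
  have hpi := Real.pi_pos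
  have h := strictConcaveOn_sin_Icc.concaveOn
  refine ⟨convex_Icc _ _, fun x hx y hy p q hp hq hpq => ?_⟩
  have := h.2 (x := -x) (y := -y) ⟨by linarith [hx.2], by linarith [hx.1]⟩
    ⟨by linarith [hy.2], by linarith [hy.1]⟩ hp hq hpq
  simp only [smul_eq_mul, Real.sin_neg] at this ⊢
  rw [show p * -x + q * -y = -(p * x + q * y) by ring, Real.sin_neg] at this
  linarith

lemma convexOn_gravity {t : ℝ} (ht : t ∈ Ioo (0 : ℝ) 1) :
    ConvexOn ℝ (Icc (-(Real.pi / 2)) 0) (gravity t) := by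
  have := convexOn_sin.smul (show (0 : ℝ) ≤ 1 - t by linarith [ht.2])
  exact this

lemma neg_abs_le_gravity {t : ℝ} (ht : t ∈ Ioo (0 : ℝ) 1) (x : ℝ) : -|x| ≤ gravity t x :=
  (abs_le.1 (abs_one_sub_mul_le ht (Real.abs_sin_le_abs (x := x)))).1

lemma phaseEnergy_eq_energy (B : ℝ → ℝ) {K : ℝ → ℝ} (hK : K ∈ W12l) :
    phaseEnergy B K = energy B gravity (deriv K) := by
  unfold phaseEnergy energy
  rw [intervalIntegral_unit, intervalIntegral_unit, sub_eq_add_neg, ← integral_neg]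
  congr 1
  refine integral_congr_ae ?_
  filter_upwards [ae_unitVol_mem] with t ht
  rw [← eq_prim_deriv hK (Ioo_subset_Icc_self ht), gravity]
  ring

/-! ### Folding angles into [-π/2, 0] -/

/-- A nonexpansive map onto `[-π/2, 0]` that does not increase the sine. -/
def fold (x : ℝ) : ℝ := -min |x| (Real.pi / 2)

lemma fold_zero : fold 0 = 0 := by
  simp [fold, (half_pos Real.pi_pos).le]

lemma fold_mem (x : ℝ) : fold x ∈ Icc (-(Real.pi / 2)) 0 := by
  have := Real.pi_pos
  exact ⟨neg_le_neg (min_le_right _ _), neg_nonpos.2 (le_min (abs_nonneg x) (by linarith))⟩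

lemma abs_fold_sub_le (x y : ℝ) : |fold x - fold y| ≤ |x - y| := by
  unfold fold
  have h := abs_abs_sub_abs_le_abs_sub x y
  rw [neg_sub_neg, abs_sub_comm]
  refine le_trans ?_ h
  have := abs_min_sub_min_le_max |x| (Real.pi / 2) |y| (Real.pi / 2)
  simpa using this

lemma sin_fold_le (x : ℝ) : Real.sin (fold x) ≤ Real.sin x := by
  unfold fold
  rcases le_total |x| (Real.pi / 2) with h | h
  · rw [min_eq_left h, Real.sin_neg]
    rcases abs_cases x with ⟨h1, h2⟩ | ⟨h1, h2⟩ <;> rw [h1] at h ⊢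
    · have := Real.sin_nonneg_of_nonneg_of_le_pi h2 (by linarith [Real.pi_pos])
      linarith
    · rw [Real.sin_neg]; linarith
  · rw [min_eq_right h, Real.sin_neg, Real.sin_pi_div_two]
    exact Real.neg_one_le_sin x

/-- The equality case of `sin_fold_le`; it locates the values of an arbitrary minimiser. -/
lemma mem_of_sin_le_sin_fold {x : ℝ} (h : Real.sin x ≤ Real.sin (fold x)) :
    x ∈ Icc (-(Real.pi / 2)) 0 ∨ Real.sin x = -1 := by
  unfold fold at h
  rcases le_total |x| (Real.pi / 2) with h' | h'
  · rw [min_eq_left h', Real.sin_neg] at h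
    left
    rcases abs_cases x with ⟨h1, h2⟩ | ⟨h1, h2⟩ <;> rw [h1] at h h'
    · have : x = 0 := by
        by_contra hne
        have := Real.sin_pos_of_pos_of_lt_pi (lt_of_le_of_ne h2 (Ne.symm hne))
          (by linarith [Real.pi_pos])
        linarith
      rw [this]
      exact ⟨by linarith [Real.pi_pos], le_rfl⟩
    · exact ⟨by linarith, h2.le⟩
  · rw [min_eq_right h', Real.sin_neg, Real.sin_pi_div_two] at h
    exact Or.inr (le_antisymm h (Real.neg_one_le_sin x))

/-- Difference quotients of T ∘ K are dominated by those of K. Where T ∘ K is not differentiable,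
`deriv` is 0 by convention and the bound is trivial, so no chain rule is needed. -/
lemma abs_deriv_comp_le {T K : ℝ → ℝ} (hT : ∀ x y, |T x - T y| ≤ |x - y|) {t : ℝ}
    (hK : DifferentiableAt ℝ K t) : |deriv (fun s => T (K s)) t| ≤ |deriv K t| := by
  by_cases hd : DifferentiableAt ℝ (fun s => T (K s)) t
  · refine le_of_tendsto_of_tendsto' (hasDerivAt_iff_tendsto_slope.1 hd.hasDerivAt).abs
      (hasDerivAt_iff_tendsto_slope.1 hK.hasDerivAt).abs fun s => ?_
    rw [slope_def_field, slope_def_field, abs_div, abs_div]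
    exact div_le_div_of_nonneg_right (hT _ _) (abs_nonneg _)
  · rw [deriv_zero_of_not_differentiableAt hd, abs_zero]
    exact abs_nonneg _

lemma ae_differentiableAt_of_mem_W12l {K : ℝ → ℝ} (hK : K ∈ W12l) :
    ∀ᵐ t ∂unitVol, DifferentiableAt ℝ K t := by
  filter_upwards [ae_restrict_of_ae hK.1.ae_differentiableAt, ae_unitVol_mem] with t ht ht'
  refine ht ?_
  rw [uIcc_of_le zero_le_one]
  exact Ioo_subset_Icc_self ht'

lemma comp_mem_W12l {T K : ℝ → ℝ} (hT : ∀ x y, |T x - T y| ≤ |x - y|) (hT0 : T 0 = 0)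
    (hK : K ∈ W12l) : (fun t => T (K t)) ∈ W12l := by
  refine ⟨?_, ?_, by simp only [hK.2.2, hT0]⟩
  · have hK1 := hK.1
    rw [absolutelyContinuousOnInterval_iff] at hK1 ⊢
    intro ε hε
    obtain ⟨δ, hδ, h⟩ := hK1 ε hε
    refine ⟨δ, hδ, fun E hE hlt => lt_of_le_of_lt (Finset.sum_le_sum fun i _ => ?_) (h E hE hlt)⟩
    rw [Real.dist_eq, Real.dist_eq]
    exact hT _ _
  · refine hK.2.1.mono (measurable_deriv _).aestronglyMeasurable ?_
    filter_upwards [ae_differentiableAt_of_mem_W12l hK] with t ht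
    exact abs_deriv_comp_le hT ht

/-! ### Existence and range of phases -/

section

variable {a b : ℝ} {B K : ℝ → ℝ}

/-- Folding does not increase the elastic term. The gravity difference is kept exactly rather than
estimated, so that the equality case can be analysed for minimisers. -/
lemma energy_fold_le (hB : IsCoeff a b B) (ha : 0 < a) (hK : K ∈ W12l) :
    energy B gravity (deriv fun t => fold (K t)) ≤ energy B gravity (deriv K)
      + ((∫ t, (1 - t) * Real.sin (fold (K t)) ∂unitVol)
        - ∫ t, (1 - t) * Real.sin (K t) ∂unitVol) := by
  have hF : (fun t => fold (K t)) ∈ W12l := comp_mem_W12l abs_fold_sub_le fold_zero hK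
  have h1 : ∫ t, B t * deriv (fun t => fold (K t)) t ^ 2 ∂unitVol
      ≤ ∫ t, B t * deriv K t ^ 2 ∂unitVol := by
    refine integral_mono_ae (hB.integrable_mul ha hF.2.1.integrable_sq)
      (hB.integrable_mul ha hK.2.1.integrable_sq) ?_
    filter_upwards [ae_differentiableAt_of_mem_W12l hK, hB.mem_Icc] with t ht htB
    refine mul_le_mul_of_nonneg_left ?_ (ha.le.trans htB.1)
    exact sq_le_sq.2 (abs_deriv_comp_le abs_fold_sub_le ht)
  have h2 : ∀ L ∈ W12l, ∫ t, gravity t (prim (deriv L) t) ∂unitVol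
      = ∫ t, (1 - t) * Real.sin (L t) ∂unitVol := fun L hL => by
    refine integral_congr_ae ?_
    filter_upwards [ae_unitVol_mem] with t ht
    rw [← eq_prim_deriv hL (Ioo_subset_Icc_self ht), gravity]
  have h3 := h2 _ hK
  have h4 := h2 _ hF
  unfold energy
  linarith

lemma continuousOn_of_mem_W12l (hK : K ∈ W12l) : ContinuousOn K (Icc 0 1) := by
  have := hK.1.continuousOn
  rwa [uIcc_of_le zero_le_one] at this

lemma continuous_fold : Continuous fold := by unfold fold; fun_prop

lemma integrable_gravity_sin {L : ℝ → ℝ} (hL : ContinuousOn L (Icc 0 1)) :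
    Integrable (fun t => (1 - t) * Real.sin (L t)) unitVol :=
  integrable_unitVol_of_continuousOn
    ((continuous_const.sub continuous_id).continuousOn.mul (Real.continuous_sin.comp_continuousOn hL))

lemma integral_sin_fold_le (hK : K ∈ W12l) : ∫ t, (1 - t) * Real.sin (fold (K t)) ∂unitVol
    ≤ ∫ t, (1 - t) * Real.sin (K t) ∂unitVol := by
  have hc := continuousOn_of_mem_W12l hK
  refine integral_mono_ae (integrable_gravity_sin (continuous_fold.comp_continuousOn hc))
    (integrable_gravity_sin hc) ?_
  filter_upwards [ae_unitVol_mem] with t ht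
  exact mul_le_mul_of_nonneg_left (sin_fold_le _) (by linarith [ht.2])

/-- The phase is a global minimiser. -/
lemma isPhase_phase (hB : IsCoeff a b B) (ha : 0 < a) : IsPhase B (phase B) := by
  refine Classical.epsilon_spec (p := IsPhase B) ?_
  -- Minimise first among states with values in [-π/2, 0], where the energy is convex; folding an
  -- arbitrary competitor then shows that the minimum is global.
  obtain ⟨u, hu, huI, hmin⟩ := exists_minimiser hB ha isPotential_gravity isClosed_Icc
    ⟨by linarith [Real.pi_pos], le_rfl⟩ (fun t ht => convexOn_gravity ht)
    (fun t ht => neg_abs_le_gravity ht)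
  refine ⟨prim u, prim_mem_W12l hu, fun K hK => ?_⟩
  change phaseEnergy B (prim u) ≤ phaseEnergy B K
  rw [phaseEnergy_eq_energy B hK, phaseEnergy_eq_energy B (prim_mem_W12l hu),
    energy_congr (ae_deriv_prim (integrable_of_memLp_two hu))]
  have hF : (fun t => fold (K t)) ∈ W12l := comp_mem_W12l abs_fold_sub_le fold_zero hK
  have h1 := hmin _ hF.2.1 fun t ht => by
    rw [← eq_prim_deriv hF ht]; exact fold_mem _
  linarith [energy_fold_le hB ha hK, integral_sin_fold_le hK]

lemma IsPhase.energy_le (hK : IsPhase B K) {v : ℝ → ℝ} (hv : MemLp v 2 unitVol) :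
    energy B gravity (deriv K) ≤ energy B gravity v := by
  have h := hK.2 (prim_mem_W12l hv)
  change phaseEnergy B K ≤ phaseEnergy B (prim v) at h
  rwa [phaseEnergy_eq_energy B hK.1, phaseEnergy_eq_energy B (prim_mem_W12l hv),
    energy_congr (ae_deriv_prim (integrable_of_memLp_two hv))] at h

lemma IsPhase.firstVar_eq_zero (hB : IsCoeff a b B) (ha : 0 < a) (hK : IsPhase B K)
    {h : ℝ → ℝ} (hh : MemLp h 2 unitVol) : firstVar B gravity' (deriv K) h = 0 :=
  PlateDesign.firstVar_eq_zero hB ha isPotential_gravity hK.1.2.1 (fun _ hv => hK.energy_le hv) hh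

/-- A phase takes its values in `[-π/2, 0]`. -/
lemma IsPhase.mem_Icc (hB : IsCoeff a b B) (ha : 0 < a) (hK : IsPhase B K) :
    ∀ t ∈ Icc (0 : ℝ) 1, K t ∈ Icc (-(Real.pi / 2)) 0 := by
  have hpi := Real.pi_pos
  have hc := continuousOn_of_mem_W12l hK.1
  have hF : (fun t => fold (K t)) ∈ W12l := comp_mem_W12l abs_fold_sub_le fold_zero hK.1
  -- The folded state has no more energy than K, and K is minimal, so folding cannot lower the
  -- gravity term at all.
  have h1 : ∫ t, (1 - t) * (Real.sin (K t) - Real.sin (fold (K t))) ∂unitVol = 0 := by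
    have h2 := hK.energy_le hF.2.1
    have h3 := energy_fold_le hB ha hK.1
    have h4 := integral_sin_fold_le hK.1
    simp only [mul_sub]
    have i2 : Integrable (fun t => (1 - t) * Real.sin (fold (K t))) unitVol :=
      integrable_gravity_sin (continuous_fold.comp_continuousOn hc)
    rw [integral_sub (integrable_gravity_sin hc) i2]
    linarith
  have hnn : 0 ≤ᵐ[unitVol] fun t => (1 - t) * (Real.sin (K t) - Real.sin (fold (K t))) := by
    filter_upwards [ae_unitVol_mem] with t ht
    exact mul_nonneg (by linarith [ht.2]) (sub_nonneg.2 (sin_fold_le _))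
  have hcont : ContinuousOn (fun t => (1 - t) * (Real.sin (K t) - Real.sin (fold (K t))))
      (Icc 0 1) :=
    (continuous_const.sub continuous_id).continuousOn.mul
      ((Real.continuous_sin.comp_continuousOn hc).sub
        (Real.continuous_sin.comp_continuousOn (continuous_fold.comp_continuousOn hc)))
  rw [integral_eq_zero_iff_of_nonneg_ae hnn (integrable_unitVol_of_continuousOn hcont)] at h1
  have h5 : EqOn (fun t => (1 - t) * (Real.sin (K t) - Real.sin (fold (K t)))) (fun _ => 0)
      (Ioo 0 1) :=
    Measure.eqOn_open_of_ae_eq h1 isOpen_Ioo (hcont.mono Ioo_subset_Icc_self)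
      continuousOn_const
  -- The endpoint 1 is excluded because the weight 1 - t vanishes there; it is recovered by
  -- continuity at the end.
  have h6 : ∀ t ∈ Ico (0 : ℝ) 1, K t ∈ Icc (-(Real.pi / 2)) 0 ∨ Real.sin (K t) = -1 := by
    intro t ht
    rcases ht.1.eq_or_lt with h0 | h0
    · rw [← h0, hK.1.2.2]
      exact Or.inl ⟨by linarith, le_rfl⟩
    · refine mem_of_sin_le_sin_fold ?_
      have h7 : (1 - t) * (Real.sin (K t) - Real.sin (fold (K t))) = 0 := h5 ⟨h0, ht.2⟩
      rcases mul_eq_zero.1 h7 with h8 | h8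
      · linarith [ht.2]
      · linarith
  have h9 : ∀ t ∈ Ico (0 : ℝ) 1, K t ∈ Icc (-(Real.pi / 2)) 0 := by
    intro t ht
    have hct : ContinuousOn K (Icc 0 t) := hc.mono (Icc_subset_Icc_right ht.2.le)
    have hK0 : K 0 = 0 := hK.1.2.2
    constructor
    · by_contra! hlt
      rcases h6 t ht with h | h
      · linarith [h.1]
      -- A sine equal to -1 forces a zero cosine, excluded on (-π, -π/2). So K, starting from 0,
      -- would have to pass through -π, where neither alternative of `h6` holds.
      · have h10 : K t ≤ -Real.pi := by
          by_contra! hgt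
          have h15 : Real.cos (K t) = 0 := by
            nlinarith [Real.sin_sq_add_cos_sq (K t)]
          have h16 := Real.cos_neg_of_pi_div_two_lt_of_lt (x := -K t) (by linarith) (by linarith)
          rw [Real.cos_neg] at h16
          linarith
        obtain ⟨s, hs, hs'⟩ := intermediate_value_Icc' ht.1 hct
          (show -Real.pi ∈ Icc (K t) (K 0) from ⟨h10, by linarith⟩)
        rcases h6 s ⟨hs.1, hs.2.trans_lt ht.2⟩ with h | h
        · linarith [h.1]
        · rw [hs'] at h; simp at h
    · by_contra! hlt
      rcases h6 t ht with h | h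
      · linarith [h.2]
      · have h10 : Real.pi ≤ K t := by
          by_contra! hgt
          have := Real.sin_pos_of_pos_of_lt_pi hlt hgt
          linarith
        obtain ⟨s, hs, hs'⟩ := intermediate_value_Icc ht.1 hct
          (show Real.pi ∈ Icc (K 0) (K t) from ⟨by linarith, h10⟩)
        rcases h6 s ⟨hs.1, hs.2.trans_lt ht.2⟩ with h | h
        · linarith [h.2]
        · rw [hs'] at h; simp at h
  intro t ht
  have hmaps : MapsTo K (Ico 0 1) (Icc (-(Real.pi / 2)) 0) := h9
  have hcl : closure (Ico (0 : ℝ) 1) = Icc 0 1 := closure_Ico (by norm_num)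
  have := hmaps.closure_of_continuousOn (by rw [hcl]; exact hc)
  rw [hcl, isClosed_Icc.closure_eq] at this
  exact this ht

end

/-! ### The adjoint problem and integrated Euler-Lagrange equations -/

/-- The potential whose Euler-Lagrange equation is the adjoint equation at the state `k`. -/
def adjoint (k : ℝ → ℝ) (t x : ℝ) : ℝ :=
  (1 - t) * (-Real.sin (k t) * (x ^ 2 / 2) - Real.cos (k t) * x)

/-- The derivative of `adjoint` in the last variable. -/
def adjoint' (k : ℝ → ℝ) (t x : ℝ) : ℝ := (1 - t) * (-Real.sin (k t) * x - Real.cos (k t))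

lemma isPotential_adjoint {k : ℝ → ℝ} (hk : Continuous k) :
    IsPotential (adjoint k) (adjoint' k) where
  continuous := by unfold adjoint; fun_prop
  continuous_deriv := by unfold adjoint'; fun_prop
  taylor t ht x h := by
    unfold adjoint adjoint'
    rw [show (1 - t) * (-Real.sin (k t) * ((x + h) ^ 2 / 2) - Real.cos (k t) * (x + h))
      - (1 - t) * (-Real.sin (k t) * (x ^ 2 / 2) - Real.cos (k t) * x)
      - (1 - t) * (-Real.sin (k t) * x - Real.cos (k t)) * h
      = (1 - t) * (-Real.sin (k t) * (h ^ 2 / 2)) by ring]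
    refine abs_one_sub_mul_le ht ?_
    rw [abs_mul, abs_neg, abs_of_nonneg (show 0 ≤ h ^ 2 / 2 by positivity)]
    nlinarith [Real.abs_sin_le_one (k t), sq_nonneg h]

lemma sin_nonpos_of_mem {x : ℝ} (hx : x ∈ Icc (-(Real.pi / 2)) 0) : Real.sin x ≤ 0 :=
  Real.sin_nonpos_of_nonpos_of_neg_pi_le hx.2 (by linarith [hx.1, Real.pi_pos])

lemma cos_nonneg_of_mem {x : ℝ} (hx : x ∈ Icc (-(Real.pi / 2)) 0) : 0 ≤ Real.cos x :=
  Real.cos_nonneg_of_mem_Icc ⟨hx.1, by linarith [hx.2, Real.pi_pos]⟩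

lemma cos_le_cos_of_mem {x y : ℝ} (hx : x ∈ Icc (-(Real.pi / 2)) 0)
    (hy : y ∈ Icc (-(Real.pi / 2)) 0) (h : x ≤ y) : Real.cos x ≤ Real.cos y := by
  rw [← Real.cos_neg x, ← Real.cos_neg y]
  exact Real.cos_le_cos_of_nonneg_of_le_pi (by linarith [hy.2])
    (by linarith [hx.1, Real.pi_pos]) (by linarith)

lemma sin_le_sin_of_mem {x y : ℝ} (hx : x ∈ Icc (-(Real.pi / 2)) 0)
    (hy : y ∈ Icc (-(Real.pi / 2)) 0) (h : x ≤ y) : Real.sin x ≤ Real.sin y :=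
  Real.sin_le_sin_of_le_of_le_pi_div_two hx.1 (by linarith [hy.2, Real.pi_pos]) h

/-- Monotonicity of the derivative of the convex sine; it gives the gravity terms a favourable sign
when two phases are compared. -/
lemma cos_sub_cos_mul_sub_nonneg {x y : ℝ} (hx : x ∈ Icc (-(Real.pi / 2)) 0)
    (hy : y ∈ Icc (-(Real.pi / 2)) 0) : 0 ≤ (Real.cos y - Real.cos x) * (y - x) := by
  rcases le_total x y with h | h
  · exact mul_nonneg (by linarith [cos_le_cos_of_mem hx hy h]) (by linarith)
  · exact mul_nonneg_of_nonpos_of_nonpos (by linarith [cos_le_cos_of_mem hy hx h]) (by linarith)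

/-- The quadratic coefficient is -(1 - t) sin (k t) / 2, nonnegative because the phase lies in
[-π/2, 0]. -/
lemma convexOn_adjoint {k : ℝ → ℝ} {t : ℝ} (ht : t ∈ Ioo (0 : ℝ) 1)
    (hk : k t ∈ Icc (-(Real.pi / 2)) 0) : ConvexOn ℝ univ (adjoint k t) := by
  refine ⟨convex_univ, fun x _ y _ p q hp hq hpq => ?_⟩
  simp only [smul_eq_mul, adjoint]
  have hs := sin_nonpos_of_mem hk
  have h1 : 0 ≤ (1 - t) * -Real.sin (k t) * (p * q) * ((x - y) ^ 2 / 2) := by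
    have : 0 ≤ 1 - t := by linarith [ht.2]
    have : 0 ≤ -Real.sin (k t) := by linarith
    positivity
  obtain rfl : q = 1 - p := by linarith
  nlinarith

lemma neg_abs_le_adjoint {k : ℝ → ℝ} {t : ℝ} (ht : t ∈ Ioo (0 : ℝ) 1)
    (hk : k t ∈ Icc (-(Real.pi / 2)) 0) (x : ℝ) : -|x| ≤ adjoint k t x := by
  have hs := sin_nonpos_of_mem hk
  have h1 : -|x| ≤ (1 - t) * (-Real.cos (k t) * x) := by
    refine (abs_le.1 (abs_one_sub_mul_le ht ?_)).1
    rw [abs_mul, abs_neg]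
    exact mul_le_of_le_one_left (abs_nonneg x) (Real.abs_cos_le_one _)
  have h2 : 0 ≤ (1 - t) * (-Real.sin (k t) * (x ^ 2 / 2)) :=
    mul_nonneg (by linarith [ht.2]) (mul_nonneg (by linarith) (by positivity))
  unfold adjoint
  linarith

section

variable {a b : ℝ} {B K : ℝ → ℝ}

lemma IsPhase.prim_mem (hB : IsCoeff a b B) (ha : 0 < a) (hK : IsPhase B K) {t : ℝ}
    (ht : t ∈ Icc (0 : ℝ) 1) : prim (deriv K) t ∈ Icc (-(Real.pi / 2)) 0 := by
  rw [← eq_prim_deriv hK.1 ht]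
  exact hK.mem_Icc hB ha t ht

/-- Existence of the adjoint state. -/
lemma exists_adjoint (hB : IsCoeff a b B) (ha : 0 < a) (hK : IsPhase B K) :
    ∃ q, MemLp q 2 unitVol ∧
      ∀ h, MemLp h 2 unitVol → firstVar B (adjoint' (prim (deriv K))) q h = 0 := by
  have hpot := isPotential_adjoint (continuous_prim (integrable_of_memLp_two hK.1.2.1))
  obtain ⟨q, hq, -, hmin⟩ := exists_minimiser hB ha hpot isClosed_univ (mem_univ 0)
    (fun t ht => convexOn_adjoint ht (hK.prim_mem hB ha (Ioo_subset_Icc_self ht)))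
    (fun t ht => neg_abs_le_adjoint ht (hK.prim_mem hB ha (Ioo_subset_Icc_self ht)))
  exact ⟨q, hq, fun h hh => firstVar_eq_zero hB ha hpot hq
    (fun v hv => hmin v hv fun _ _ => mem_univ _) hh⟩

/-- The Euler-Lagrange equation in integrated form. -/
lemma ae_flux_eq {Φ' : ℝ → ℝ → ℝ} {u : ℝ → ℝ} (hB : IsCoeff a b B) (ha : 0 < a)
    (hΦ' : Continuous fun p : ℝ × ℝ => Φ' p.1 p.2) (hu : MemLp u 2 unitVol)
    (hEL : ∀ h, MemLp h 2 unitVol → firstVar B Φ' u h = 0) :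
    ∀ᵐ t ∂unitVol, B t * u t = -∫ s in t..1, Φ' s (prim u s) := by
  have iu := integrable_of_memLp_two hu
  have hψ : Continuous fun s => Φ' s (prim u s) :=
    hΦ'.comp (continuous_id.prodMk (continuous_prim iu))
  have hWc : Continuous fun t => ∫ s in t..1, Φ' s (prim u s) := by
    have h := (intervalIntegral.continuous_primitive (μ := volume)
      (fun x y => hψ.intervalIntegrable x y) 1).neg
    exact h.congr fun t => (intervalIntegral.integral_symm 1 t).symm
  have hBu : MemLp (fun t => B t * u t) 2 unitVol := by
    refine hu.of_le_mul (c := b)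
      (hB.aemeasurable.aestronglyMeasurable.mul hu.aestronglyMeasurable) ?_
    filter_upwards [hB.abs_le ha] with t ht
    rw [norm_mul]
    exact mul_le_mul_of_nonneg_right ht (norm_nonneg _)
  have hW : MemLp (fun t => ∫ s in t..1, Φ' s (prim u s)) 2 unitVol := by
    rw [memLp_two_iff_integrable_sq hWc.aestronglyMeasurable]
    exact integrable_unitVol_of_continuousOn (hWc.pow 2).continuousOn
  have hr : MemLp (fun t => B t * u t + ∫ s in t..1, Φ' s (prim u s)) 2 unitVol := hBu.add hW
  -- The residual itself is the test function; after integration by parts its squared L² norm is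
  -- zero.
  have h := hEL _ hr
  unfold firstVar at h
  have i1 : Integrable (fun t => B t * (u t * (B t * u t + ∫ s in t..1, Φ' s (prim u s)))) unitVol :=
    hB.integrable_mul ha (integrable_mul_of_memLp hu hr)
  have i2 : Integrable (fun t => (∫ s in t..1, Φ' s (prim u s)) *
      (B t * u t + ∫ s in t..1, Φ' s (prim u s))) unitVol := integrable_mul_of_memLp hW hr
  rw [integral_mul_prim hψ (integrable_of_memLp_two hr), ← integral_add i1 i2] at h
  have h0 : ∫ t, (B t * u t + ∫ s in t..1, Φ' s (prim u s)) ^ 2 ∂unitVol = 0 := by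
    rw [← h]
    exact integral_congr_ae (Filter.Eventually.of_forall fun t => by ring)
  rw [integral_eq_zero_iff_of_nonneg (fun _ => sq_nonneg _) hr.integrable_sq] at h0
  filter_upwards [h0] with t ht
  have : B t * u t + ∫ s in t..1, Φ' s (prim u s) = 0 := pow_eq_zero_iff two_ne_zero |>.1 ht
  linarith

/-! ### Sensitivity of phase and compliance to the hardness -/

variable {d K' : ℝ → ℝ} {ε D : ℝ}

/-- Lipschitz dependence of the phase on the hardness. -/
lemma integral_sq_deriv_sub_le (ha : 0 < a) (hB : IsCoeff a b B)
    (hB' : IsCoeff a b fun t => B t + ε * d t)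
    (hd : ∀ᵐ t ∂unitVol, |d t| ≤ D) (hK : IsPhase B K)
    (hK' : IsPhase (fun t => B t + ε * d t) K') :
    ∫ t, (deriv K' t - deriv K t) ^ 2 ∂unitVol
      ≤ (D / a) ^ 2 * (∫ t, deriv K t ^ 2 ∂unitVol) * ε ^ 2 := by
  have hu := hK.1.2.1
  have hu' := hK'.1.2.1
  have iu := integrable_of_memLp_two hu
  have iu' := integrable_of_memLp_two hu'
  have hh : MemLp (fun t => deriv K' t - deriv K t) 2 unitVol := hu'.sub hu
  have ih := integrable_of_memLp_two hh
  have e1 := hK.firstVar_eq_zero hB ha hh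
  have e2 := hK'.firstVar_eq_zero hB' ha hh
  unfold firstVar at e1 e2
  have i1 := hB.integrable_mul ha (integrable_mul_of_memLp hu hh)
  have i2 := hB'.integrable_mul ha (integrable_mul_of_memLp hu' hh)
  -- Both state equations are tested with the difference of the phases; by monotonicity the gravity
  -- terms can be dropped.
  have h1 : ∫ t, gravity' t (prim (deriv K) t) * prim (fun t => deriv K' t - deriv K t) t ∂unitVol
      ≤ ∫ t, gravity' t (prim (deriv K') t) * prim (fun t => deriv K' t - deriv K t) t
        ∂unitVol := by
    refine integral_mono_ae
      (integrable_comp_prim_mul isPotential_gravity.continuous_deriv iu ih)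
      (integrable_comp_prim_mul isPotential_gravity.continuous_deriv iu' ih) ?_
    filter_upwards [ae_unitVol_mem] with t ht
    have h2 := cos_sub_cos_mul_sub_nonneg (hK.prim_mem hB ha (Ioo_subset_Icc_self ht))
      (hK'.prim_mem hB' ha (Ioo_subset_Icc_self ht))
    have h3 := mul_nonneg (show 0 ≤ 1 - t by linarith [ht.2]) h2
    rw [prim_sub iu' iu]
    unfold gravity'
    linarith
  have h2 : ∫ t, (a / 2 * (deriv K' t - deriv K t) ^ 2
      - ε ^ 2 * D ^ 2 / (2 * a) * deriv K t ^ 2) ∂unitVol ≤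
      ∫ t, ((B t + ε * d t) * (deriv K' t * (deriv K' t - deriv K t))
        - B t * (deriv K t * (deriv K' t - deriv K t))) ∂unitVol := by
    refine integral_mono_ae ((hh.integrable_sq.const_mul _).sub (hu.integrable_sq.const_mul _))
      (i2.sub i1) ?_
    filter_upwards [hB'.mem_Icc, hd] with t ht hdt
    have h3 := mul_nonneg (sub_nonneg.2 ht.1) (sq_nonneg (deriv K' t - deriv K t))
    have h4 : d t ^ 2 * deriv K t ^ 2 ≤ D ^ 2 * deriv K t ^ 2 := by
      have : d t ^ 2 ≤ D ^ 2 := by rw [← sq_abs (d t)]; gcongr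
      gcongr
    -- Young's inequality as a completed square: half of the coercivity absorbs the cross term ε d
    -- K' (K'_new - K').
    have h5 : 0 ≤ (a * (deriv K' t - deriv K t) + ε * d t * deriv K t) ^ 2 / (2 * a) := by
      positivity
    have h6 : (a * (deriv K' t - deriv K t) + ε * d t * deriv K t) ^ 2 / (2 * a)
        = a / 2 * (deriv K' t - deriv K t) ^ 2 + ε * d t * deriv K t * (deriv K' t - deriv K t)
          + ε ^ 2 / (2 * a) * (d t ^ 2 * deriv K t ^ 2) := by
      field_simp; ring
    have h7 : ε ^ 2 / (2 * a) * (d t ^ 2 * deriv K t ^ 2)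
        ≤ ε ^ 2 / (2 * a) * (D ^ 2 * deriv K t ^ 2) := by gcongr
    have h8 : ε ^ 2 / (2 * a) * (D ^ 2 * deriv K t ^ 2)
        = ε ^ 2 * D ^ 2 / (2 * a) * deriv K t ^ 2 := by ring
    change a / 2 * (deriv K' t - deriv K t) ^ 2 - ε ^ 2 * D ^ 2 / (2 * a) * deriv K t ^ 2
      ≤ (B t + ε * d t) * (deriv K' t * (deriv K' t - deriv K t))
        - B t * (deriv K t * (deriv K' t - deriv K t))
    nlinarith
  rw [integral_sub (hh.integrable_sq.const_mul _) (hu.integrable_sq.const_mul _),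
    integral_sub i2 i1, integral_const_mul, integral_const_mul] at h2
  have h3 : a / 2 * ∫ t, (deriv K' t - deriv K t) ^ 2 ∂unitVol
      ≤ a / 2 * ((D / a) ^ 2 * (∫ t, deriv K t ^ 2 ∂unitVol) * ε ^ 2) := by
    have : a / 2 * ((D / a) ^ 2 * (∫ t, deriv K t ^ 2 ∂unitVol) * ε ^ 2)
      = ε ^ 2 * D ^ 2 / (2 * a) * ∫ t, deriv K t ^ 2 ∂unitVol := by field_simp
    linarith
  exact le_of_mul_le_mul_left h3 (by positivity)

/-- The first order expansion of the compliance through the adjoint state. -/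
lemma compliance_le {q : ℝ → ℝ} (ha : 0 < a) (hB : IsCoeff a b B)
    (hB' : IsCoeff a b fun t => B t + ε * d t) (hdm : AEMeasurable d unitVol)
    (hd : ∀ᵐ t ∂unitVol, |d t| ≤ D) (hK : IsPhase B K)
    (hK' : IsPhase (fun t => B t + ε * d t) K') (hq : MemLp q 2 unitVol)
    (hqEL : ∀ h, MemLp h 2 unitVol → firstVar B (adjoint' (prim (deriv K))) q h = 0) :
    (∫ t, (1 - t) * Real.sin (K t) ∂unitVol) - ∫ t, (1 - t) * Real.sin (K' t) ∂unitVol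
      ≤ ε * (∫ t, d t * (deriv K t * q t) ∂unitVol)
        + (1 + ∫ t, |q t| ∂unitVol + D / 2) * (∫ t, (deriv K' t - deriv K t) ^ 2 ∂unitVol)
        + D / 2 * ε ^ 2 * ∫ t, q t ^ 2 ∂unitVol := by
  have hu := hK.1.2.1
  have hu' := hK'.1.2.1
  have iu := integrable_of_memLp_two hu
  have iu' := integrable_of_memLp_two hu'
  have iq := integrable_of_memLp_two hq
  have hh : MemLp (fun t => deriv K' t - deriv K t) 2 unitVol := hu'.sub hu
  have ih := integrable_of_memLp_two hh
  have e1 := hK.firstVar_eq_zero hB ha hq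
  have e2 := hK'.firstVar_eq_zero hB' ha hq
  have e3 := hqEL _ hh
  unfold firstVar at e1 e2 e3
  have hpot := isPotential_adjoint (continuous_prim iu)
  have i1 := integrable_gravity_sin (continuousOn_of_mem_W12l hK.1)
  have i2 := integrable_gravity_sin (continuousOn_of_mem_W12l hK'.1)
  have i3 := hB.integrable_mul ha (integrable_mul_of_memLp hu hq)
  have i4 := integrable_comp_prim_mul isPotential_gravity.continuous_deriv iu iq
  have i5 := hB'.integrable_mul ha (integrable_mul_of_memLp hu' hq)
  have i6 := integrable_comp_prim_mul isPotential_gravity.continuous_deriv iu' iq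
  have i7 := hB.integrable_mul ha (integrable_mul_of_memLp hq hh)
  have i8 := integrable_comp_prim_mul hpot.continuous_deriv iq ih
  have i9 : Integrable (fun t => d t * (deriv K t * q t)) unitVol :=
    (integrable_mul_of_memLp hu hq).bdd_mul hdm.aestronglyMeasurable hd
  have i10 := integrable_sq_prim ih
  -- The compliance difference, plus the new minus the old state equation tested with q, minus the
  -- adjoint equation tested with the phase difference. The added terms integrate to zero, and
  -- pointwise they cancel all first order terms except ε d K'_new q.
  have j := ((i1.sub i2).add ((i5.add i6).sub (i3.add i4))).sub (i7.add i8)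
  have j' := (i9.const_mul ε).add (((i10.const_mul (1 + ∫ t, |q t| ∂unitVol)).add
    (hh.integrable_sq.const_mul (D / 2))).add (hq.integrable_sq.const_mul (D / 2 * ε ^ 2)))
  have hmono := integral_mono_ae j j' (by
    filter_upwards [ae_unitVol_mem, hd] with t ht hdt
    have ht' := Ioo_subset_Icc_self ht
    simp only [Pi.add_apply, Pi.sub_apply]
    rw [eq_prim_deriv hK.1 ht', eq_prim_deriv hK'.1 ht', prim_sub iu' iu]
    set x := prim (deriv K) t
    set y := prim (deriv K') t
    have r1 := abs_sin_taylor_le x (y - x)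
    have r2 := abs_cos_taylor_le x (y - x)
    rw [add_sub_cancel] at r1 r2
    have r1' := abs_one_sub_mul_le ht r1
    have r2' := abs_one_sub_mul_le ht r2
    have hP := abs_prim_le iq t
    have r3 : (1 - t) * (Real.cos y - Real.cos x + Real.sin x * (y - x)) * prim q t
        ≤ (∫ t, |q t| ∂unitVol) * (y - x) ^ 2 := by
      refine (le_abs_self _).trans ?_
      rw [abs_mul, mul_comm]
      exact mul_le_mul hP r2' (abs_nonneg _) ((abs_nonneg _).trans hP)
    -- Cost of replacing the perturbed derivative by the unperturbed one in the first order term.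
    have r4 : ε * d t * ((deriv K' t - deriv K t) * q t)
        ≤ D / 2 * (deriv K' t - deriv K t) ^ 2 + D / 2 * ε ^ 2 * q t ^ 2 := by
      have s1 : d t * ((deriv K' t - deriv K t) * (ε * q t))
          ≤ D * (((deriv K' t - deriv K t) ^ 2 + (ε * q t) ^ 2) / 2) := by
        refine (le_abs_self _).trans ?_
        rw [abs_mul]
        refine mul_le_mul hdt ?_ (abs_nonneg _) ((abs_nonneg _).trans hdt)
        rw [abs_le]
        constructor <;> nlinarith [sq_nonneg (deriv K' t - deriv K t - ε * q t),
          sq_nonneg (deriv K' t - deriv K t + ε * q t)]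
      nlinarith
    have r5 := (abs_le.1 r1').1
    unfold gravity' adjoint'
    nlinarith)
  have hN := integral_sq_prim_le hh
  have hM : 0 ≤ 1 + ∫ t, |q t| ∂unitVol :=
    add_nonneg zero_le_one (integral_nonneg fun _ => abs_nonneg _)
  rw [integral_sub' ((i1.sub i2).add ((i5.add i6).sub (i3.add i4))) (i7.add i8),
    integral_add' (i1.sub i2) ((i5.add i6).sub (i3.add i4)), integral_sub' i1 i2,
    integral_sub' (i5.add i6) (i3.add i4), integral_add' i5 i6, integral_add' i3 i4,
    integral_add' i7 i8, e1, e2, e3,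
    integral_add' (i9.const_mul ε) (((i10.const_mul (1 + ∫ t, |q t| ∂unitVol)).add
    (hh.integrable_sq.const_mul (D / 2))).add (hq.integrable_sq.const_mul (D / 2 * ε ^ 2))),
    integral_add' ((i10.const_mul (1 + ∫ t, |q t| ∂unitVol)).add
    (hh.integrable_sq.const_mul (D / 2))) (hq.integrable_sq.const_mul (D / 2 * ε ^ 2)),
    integral_add' (i10.const_mul (1 + ∫ t, |q t| ∂unitVol))
    (hh.integrable_sq.const_mul (D / 2)), integral_const_mul, integral_const_mul,
    integral_const_mul, integral_const_mul] at hmono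
  nlinarith [mul_le_mul_of_nonneg_left hN hM]

end

/-! ### First order optimality conditions for the design -/

section

variable {a b c : ℝ} {θ η : ℝ → ℝ}

lemma isCoeff_hardness (hab : a < b) (hθ : θ ∈ designs) : IsCoeff a b (hardness a b θ) where
  aemeasurable := by
    unfold hardness
    exact ((aemeasurable_const.sub hθ.1).mul_const a).add (hθ.1.mul_const b)
  mem_Icc := by
    filter_upwards [hθ.2] with t ht
    unfold hardness
    constructor <;> nlinarith [ht.1, ht.2]

lemma integrable_design (hθ : θ ∈ designs) : Integrable θ unitVol := by
  refine Integrable.of_bound hθ.1.aestronglyMeasurable 1 ?_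
  filter_upwards [hθ.2] with t ht
  rw [Real.norm_eq_abs, abs_of_nonneg ht.1]; exact ht.2

lemma reducedCost_eq : reducedCost a b c θ
    = -(∫ t, (1 - t) * Real.sin (phase (hardness a b θ) t) ∂unitVol) + c * ∫ t, θ t ∂unitVol := by
  unfold reducedCost cost
  rw [intervalIntegral_unit, intervalIntegral_unit]

/-- The first order necessary condition in variational form. -/
lemma IsOptimalDesign.variation_nonneg (ha : 0 < a) (hab : a < b)
    (hθ : IsOptimalDesign a b c θ) (hη : η ∈ designs) {q : ℝ → ℝ} (hq : MemLp q 2 unitVol)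
    (hqEL : ∀ h, MemLp h 2 unitVol → firstVar (hardness a b θ)
      (adjoint' (prim (deriv (phase (hardness a b θ))))) q h = 0) :
    0 ≤ ∫ t, ((b - a) * (deriv (phase (hardness a b θ)) t * q t) + c) * (η t - θ t)
      ∂unitVol := by
  set B := hardness a b θ with hBdef
  have hB : IsCoeff a b B := isCoeff_hardness hab hθ.1
  have hK := isPhase_phase hB ha
  set K := phase B
  have hu := hK.1.2.1
  set d : ℝ → ℝ := fun t => (b - a) * (η t - θ t) with hd
  have hdm : AEMeasurable d unitVol := (hη.1.sub hθ.1.1).const_mul _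
  have hdb : ∀ᵐ t ∂unitVol, |d t| ≤ b - a := by
    filter_upwards [hη.2, hθ.1.2] with t h1 h2
    rw [hd, abs_mul, abs_of_pos (sub_pos.2 hab)]
    exact mul_le_of_le_one_right (by linarith)
      (abs_le.2 ⟨by linarith [h1.1, h2.2], by linarith [h1.2, h2.1]⟩)
  have iθ := integrable_design hθ.1
  have iη := integrable_design hη
  have i9 : Integrable (fun t => d t * (deriv K t * q t)) unitVol :=
    (integrable_mul_of_memLp hu hq).bdd_mul hdm.aestronglyMeasurable hdb
  have iδ : Integrable (fun t => η t - θ t) unitVol := iη.sub iθ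
  have hsplit : ∫ t, ((b - a) * (deriv K t * q t) + c) * (η t - θ t) ∂unitVol
      = (∫ t, d t * (deriv K t * q t) ∂unitVol)
        + c * ((∫ t, η t ∂unitVol) - ∫ t, θ t ∂unitVol) := by
    rw [← integral_sub iη iθ, ← integral_const_mul,
      ← integral_add i9 (iδ.const_mul c)]
    exact integral_congr_ae (Filter.Eventually.of_forall fun t => by simp only [hd]; ring)
  rw [hsplit]
  -- The constant collects the remainders of `compliance_le` with D = b - a, after inserting the
  -- Lipschitz bound for the phase.
  refine nonneg_of_forall_linear_add_sq
    (C := (1 + ∫ t, |q t| ∂unitVol + (b - a) / 2) *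
      (((b - a) / a) ^ 2 * (∫ t, deriv K t ^ 2 ∂unitVol))
      + (b - a) / 2 * ∫ t, q t ^ 2 ∂unitVol) fun ε hε => ?_
  have hθε : (fun t => θ t + ε * (η t - θ t)) ∈ designs := by
    refine ⟨hθ.1.1.add ((hη.1.sub hθ.1.1).const_mul ε), ?_⟩
    filter_upwards [hη.2, hθ.1.2] with t h1 h2
    constructor <;> nlinarith [h1.1, h1.2, h2.1, h2.2, hε.1, hε.2]
  have hBε : hardness a b (fun t => θ t + ε * (η t - θ t)) = fun t => B t + ε * d t := by
    funext t; simp only [hBdef, hardness, hd]; ring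
  have hB' : IsCoeff a b fun t => B t + ε * d t := hBε ▸ isCoeff_hardness hab hθε
  have hK' := isPhase_phase hB' ha
  have hmin : reducedCost a b c θ ≤ reducedCost a b c (fun t => θ t + ε * (η t - θ t)) :=
    hθ.2 hθε
  rw [reducedCost_eq, reducedCost_eq, hBε, integral_add iθ (iδ.const_mul ε),
    integral_const_mul, integral_sub iη iθ] at hmin
  have h1 := compliance_le ha hB hB' hdm hdb hK hK' hq hqEL
  have h2 := integral_sq_deriv_sub_le ha hB hB' hdb hK hK'
  have hM : 0 ≤ 1 + ∫ t, |q t| ∂unitVol + (b - a) / 2 :=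
    add_nonneg (add_nonneg zero_le_one (integral_nonneg fun _ => abs_nonneg _)) (by linarith)
  have h3 := mul_le_mul_of_nonneg_left h2 hM
  linarith

/-- The first order necessary condition in pointwise form. -/
lemma IsOptimalDesign.ae_sign_condition (ha : 0 < a) (hab : a < b)
    (hθ : IsOptimalDesign a b c θ) {q : ℝ → ℝ} (hq : MemLp q 2 unitVol)
    (hqEL : ∀ h, MemLp h 2 unitVol → firstVar (hardness a b θ)
      (adjoint' (prim (deriv (phase (hardness a b θ))))) q h = 0) :
    ∀ᵐ t ∂unitVol,
      (0 < (b - a) * (deriv (phase (hardness a b θ)) t * q t) + c → θ t = 0) ∧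
      ((b - a) * (deriv (phase (hardness a b θ)) t * q t) + c < 0 → θ t = 1) := by
  have hu := (isPhase_phase (isCoeff_hardness hab hθ.1) ha).1.2.1
  set f : ℝ → ℝ := fun t => (b - a) * (deriv (phase (hardness a b θ)) t * q t) + c with hf
  have hfi : Integrable f unitVol :=
    ((integrable_mul_of_memLp hu hq).const_mul _).add (integrable_const c)
  -- A projected gradient step: f (η - θ) is nonpositive pointwise and vanishes only where the sign
  -- condition holds. One competitor thus replaces localisation on sets.
  set η : ℝ → ℝ := fun t => max 0 (min 1 (θ t - f t)) with hηdef
  have hη : η ∈ designs := by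
    refine ⟨aemeasurable_const.max (aemeasurable_const.min (hθ.1.1.sub hfi.aemeasurable)), ?_⟩
    exact Filter.Eventually.of_forall fun t =>
      ⟨le_max_left _ _, max_le zero_le_one (min_le_left _ _)⟩
  have h1 : 0 ≤ ∫ t, f t * (η t - θ t) ∂unitVol := hθ.variation_nonneg ha hab hη hq hqEL
  have hpt : ∀ᵐ t ∂unitVol, f t * (η t - θ t) ≤ 0 := by
    filter_upwards [hθ.1.2] with t ht
    rcases le_total 0 (f t) with h | h
    · refine mul_nonpos_of_nonneg_of_nonpos h (sub_nonpos.2 (max_le ht.1 ?_))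
      exact (min_le_right _ _).trans (by linarith)
    · refine mul_nonpos_of_nonpos_of_nonneg h (sub_nonneg.2 (le_max_of_le_right ?_))
      exact le_min ht.2 (by linarith)
  have hi : Integrable (fun t => f t * (η t - θ t)) unitVol := by
    have := hfi.bdd_mul (c := 1) (hη.1.sub hθ.1.1).aestronglyMeasurable (by
      filter_upwards [hη.2, hθ.1.2] with t h1 h2
      exact abs_le.2 ⟨by simp only [Pi.sub_apply]; linarith [h1.1, h2.2],
        by simp only [Pi.sub_apply]; linarith [h1.2, h2.1]⟩)
    exact this.congr (Filter.Eventually.of_forall fun t => mul_comm _ _)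
  have h2 : ∫ t, -(f t * (η t - θ t)) ∂unitVol = 0 := by
    refine le_antisymm (by rw [integral_neg]; linarith) (integral_nonneg_of_ae ?_)
    filter_upwards [hpt] with t ht
    exact neg_nonneg.2 ht
  rw [integral_eq_zero_iff_of_nonneg_ae (hpt.mono fun t ht => neg_nonneg.2 ht) hi.neg] at h2
  filter_upwards [h2, hθ.1.2] with t ht htm
  have h3 : f t * (η t - θ t) = 0 := neg_eq_zero.1 ht
  constructor <;> intro hs
  · have h4 : η t = θ t := by
      rcases mul_eq_zero.1 h3 with h | h
      · exact absurd h (ne_of_gt hs)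
      · linarith
    by_contra hne
    have hpos : 0 < θ t := lt_of_le_of_ne htm.1 (Ne.symm hne)
    have : η t < θ t := max_lt hpos ((min_le_right _ _).trans_lt (by
      have : 0 < f t := hs
      linarith))
    linarith
  · have h4 : η t = θ t := by
      rcases mul_eq_zero.1 h3 with h | h
      · exact absurd h (ne_of_lt hs)
      · linarith
    by_contra hne
    have hlt : θ t < 1 := lt_of_le_of_ne htm.2 hne
    have : θ t < η t := lt_max_of_lt_right (lt_min hlt (by
      have : f t < 0 := hs
      linarith))
    linarith

end

/-! ### Extremals: monotonicity, smoothness and shape -/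

/-- The hardness in `[a, b]` closest to `√x`. -/
def clampSqrt (a b x : ℝ) : ℝ := max a (min b √x)

lemma continuous_clampSqrt (a b : ℝ) : Continuous (clampSqrt a b) := by
  unfold clampSqrt; fun_prop

/-- State `k` and adjoint state `P` with their fluxes `m` and `p`, for the hardness determined by
the product of the fluxes. -/
structure IsExtremal (a b κ : ℝ) (k P m p : ℝ → ℝ) : Prop where
  continuous_k : Continuous k
  continuous_P : Continuous P
  k_mem : ∀ t ∈ Icc (0 : ℝ) 1, k t ∈ Icc (-(Real.pi / 2)) 0
  hasDerivAt_m : ∀ t, HasDerivAt m ((1 - t) * Real.cos (k t)) t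
  hasDerivAt_p : ∀ t, HasDerivAt p (-((1 - t) * (Real.cos (k t) + Real.sin (k t) * P t))) t
  m_one : m 1 = 0
  p_one : p 1 = 0
  hasDerivAt_k : ∀ t ∈ Ioo (0 : ℝ) 1,
    HasDerivAt k (m t / clampSqrt a b (κ * -(m t * p t))) t
  hasDerivAt_P : ∀ t ∈ Ioo (0 : ℝ) 1,
    HasDerivAt P (p t / clampSqrt a b (κ * -(m t * p t))) t

namespace IsExtremal

variable {a b κ : ℝ} {k P m p : ℝ → ℝ}

lemma continuous_m (h : IsExtremal a b κ k P m p) : Continuous m :=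
  continuous_iff_continuousAt.2 fun t => (h.hasDerivAt_m t).continuousAt

lemma continuous_p (h : IsExtremal a b κ k P m p) : Continuous p :=
  continuous_iff_continuousAt.2 fun t => (h.hasDerivAt_p t).continuousAt

lemma monotoneOn_m (h : IsExtremal a b κ k P m p) : MonotoneOn m (Icc 0 1) := by
  refine monotoneOn_of_hasDerivWithinAt_nonneg (convex_Icc 0 1) h.continuous_m.continuousOn
    (fun t _ => (h.hasDerivAt_m t).hasDerivWithinAt) fun t ht => ?_
  rw [interior_Icc] at ht
  exact mul_nonneg (by linarith [ht.2]) (cos_nonneg_of_mem (h.k_mem t (Ioo_subset_Icc_self ht)))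

lemma m_nonpos (h : IsExtremal a b κ k P m p) {t : ℝ} (ht : t ∈ Icc (0 : ℝ) 1) : m t ≤ 0 := by
  rw [← h.m_one]
  exact h.monotoneOn_m ht (right_mem_Icc.2 zero_le_one) ht.2

lemma clampSqrt_pos (ha : 0 < a) (x : ℝ) : 0 < clampSqrt a b x := lt_max_of_lt_left ha

lemma antitoneOn_k (ha : 0 < a) (h : IsExtremal a b κ k P m p) : AntitoneOn k (Icc 0 1) := by
  refine antitoneOn_of_hasDerivWithinAt_nonpos (convex_Icc 0 1) h.continuous_k.continuousOn
    (fun t ht => (h.hasDerivAt_k t (by rwa [interior_Icc] at ht)).hasDerivWithinAt) fun t ht => ?_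
  rw [interior_Icc] at ht
  exact div_nonpos_of_nonpos_of_nonneg (h.m_nonpos (Ioo_subset_Icc_self ht)) (clampSqrt_pos ha _).le

/-- The source of the adjoint flux is positive wherever that flux is. -/
lemma source_pos (ha : 0 < a) (h : IsExtremal a b κ k P m p) {t : ℝ} (ht : t ∈ Icc (0 : ℝ) 1)
    (hp : 0 < p t) : 0 < Real.cos (k t) + Real.sin (k t) * P t := by
  by_contra! hD
  have hS : IsCompact {s | s ∈ Icc t 1 ∧ p s ≤ 0} :=
    isCompact_Icc.inter_right (isClosed_le h.continuous_p continuous_const)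
  -- The first point from t onwards where p is no longer positive; it exists because p 1 = 0.
  obtain ⟨r, ⟨hr, hpr⟩, hmin⟩ := hS.exists_isLeast ⟨1, right_mem_Icc.2 ht.2, h.p_one.le⟩
  have hpos : ∀ s ∈ Ico t r, 0 < p s := fun s hs => by
    by_contra! hle
    exact absurd (hmin ⟨⟨hs.1, hs.2.le.trans hr.2⟩, hle⟩) (not_le.2 hs.2)
  have hsub : ∀ s ∈ Ioo t r, s ∈ Ioo (0 : ℝ) 1 := fun s hs =>
    ⟨ht.1.trans_lt hs.1, hs.2.trans_le hr.2⟩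
  have hPm : MonotoneOn P (Icc t r) := by
    refine monotoneOn_of_hasDerivWithinAt_nonneg (convex_Icc t r) h.continuous_P.continuousOn
      (fun s hs => (h.hasDerivAt_P s (hsub s (by rwa [interior_Icc] at hs))).hasDerivWithinAt)
      fun s hs => ?_
    rw [interior_Icc] at hs
    exact div_nonneg (hpos s (Ioo_subset_Ico_self hs)).le (clampSqrt_pos ha _).le
  have hkt := h.k_mem t ht
  have hst := sin_nonpos_of_mem hkt
  have hct := cos_nonneg_of_mem hkt
  -- Were P t negative, both summands of the source would be nonnegative, hence zero, and sine and
  -- cosine would vanish together.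
  have hPt : 0 ≤ P t := by
    by_contra! hneg
    have h1 := mul_nonneg_of_nonpos_of_nonpos hst hneg.le
    have h2 : Real.cos (k t) = 0 := by linarith
    have h3 : Real.sin (k t) = 0 :=
      (mul_eq_zero.1 (show Real.sin (k t) * P t = 0 by linarith)).resolve_right hneg.ne
    simpa [h2, h3] using Real.sin_sq_add_cos_sq (k t)
  have hDs : ∀ s ∈ Ioo t r, Real.cos (k s) + Real.sin (k s) * P s ≤ 0 := by
    intro s hs
    have hs01 := Ioo_subset_Icc_self (hsub s hs)
    have hks := h.k_mem s hs01
    have hle := h.antitoneOn_k ha ht hs01 hs.1.le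
    have h1 := cos_le_cos_of_mem hks hkt hle
    have h2 := sin_le_sin_of_mem hks hkt hle
    have h3 : P t ≤ P s := hPm (left_mem_Icc.2 hr.1) (Ioo_subset_Icc_self hs) hs.1.le
    nlinarith
  -- The source stays nonpositive, so p cannot descend from p t > 0 to p r ≤ 0.
  have hmono : MonotoneOn p (Icc t r) := by
    refine monotoneOn_of_hasDerivWithinAt_nonneg (convex_Icc t r) h.continuous_p.continuousOn
      (fun s _ => (h.hasDerivAt_p s).hasDerivWithinAt) fun s hs => ?_
    rw [interior_Icc] at hs
    have := mul_nonpos_of_nonneg_of_nonpos (show 0 ≤ 1 - s by linarith [(hsub s hs).2]) (hDs s hs)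
    linarith
  linarith [hmono (left_mem_Icc.2 hr.1) (right_mem_Icc.2 hr.1) hr.1]

/-- Where the adjoint flux is positive, it is strictly decreasing. -/
lemma p_lt (ha : 0 < a) (h : IsExtremal a b κ k P m p) {s t : ℝ} (hs : 0 ≤ s) (hst : s < t)
    (ht : t ≤ 1) (hp : 0 < p t) : p t < p s := by
  have hanti : ∀ r ∈ Icc s t, (∀ x ∈ Ioo r t, 0 < p x) → r < t → p t < p r := by
    intro r hr hpos hrt
    refine strictAntiOn_of_hasDerivWithinAt_neg (convex_Icc r t) h.continuous_p.continuousOn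
      (fun x _ => (h.hasDerivAt_p x).hasDerivWithinAt) (fun x hx => ?_)
      (left_mem_Icc.2 hr.2) (right_mem_Icc.2 hr.2) hrt
    rw [interior_Icc] at hx
    have hx1 : x < 1 := hx.2.trans_le ht
    have := mul_pos (sub_pos.2 hx1)
      (h.source_pos ha ⟨hs.trans (hr.1.trans hx.1.le), hx1.le⟩ (hpos x hx))
    linarith
  -- If p were nonpositive somewhere in [s, t], it would be positive after the last such point r,
  -- hence decreasing there, and p t < p r ≤ 0.
  by_cases hex : ∃ r ∈ Icc s t, p r ≤ 0
  · have hS : IsCompact {r | r ∈ Icc s t ∧ p r ≤ 0} :=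
      isCompact_Icc.inter_right (isClosed_le h.continuous_p continuous_const)
    obtain ⟨r, ⟨hr, hpr⟩, hmax⟩ := hS.exists_isGreatest hex
    have hrt : r < t := lt_of_le_of_ne hr.2 (by rintro rfl; linarith)
    have := hanti r hr (fun x hx => by
      by_contra! hle
      exact absurd (hmax ⟨⟨hr.1.trans hx.1.le, hx.2.le⟩, hle⟩) (not_le.2 hx.1)) hrt
    linarith
  · push Not at hex
    exact hanti s ⟨le_rfl, hst.le⟩ (fun x hx => hex x (Ioo_subset_Icc_self hx)) hst

/-- Where the product of the fluxes is positive, it is strictly decreasing. -/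
lemma flux_mul_lt (ha : 0 < a) (hκ : 0 < κ) (h : IsExtremal a b κ k P m p) {s t : ℝ} (hs : 0 ≤ s)
    (hst : s < t) (ht : t ≤ 1) (hpos : 0 < κ * -(m t * p t)) :
    κ * -(m t * p t) < κ * -(m s * p s) := by
  have hmt := h.m_nonpos ⟨hs.trans hst.le, ht⟩
  have hms : m s ≤ m t := h.monotoneOn_m ⟨hs, hst.le.trans ht⟩ ⟨hs.trans hst.le, ht⟩ hst.le
  have h1 : 0 < -(m t * p t) := (mul_pos_iff_of_pos_left hκ).1 hpos
  have hm : m t < 0 := lt_of_le_of_ne hmt fun h0 => by rw [h0] at h1; simp at h1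
  have hp : 0 < p t := by
    by_contra! hle
    nlinarith
  have hps := h.p_lt ha hs hst ht hp
  refine mul_lt_mul_of_pos_left ?_ hκ
  nlinarith

/-- Smoothness of extremals where the hardness is strictly between its bounds. -/
lemma contDiffOn_flux_mul (ha : 0 < a) (h : IsExtremal a b κ k P m p) {s t : ℝ} (hs : 0 ≤ s)
    (ht : t ≤ 1) (hint : ∀ x ∈ Ioo s t, κ * -(m x * p x) ∈ Ioo (a ^ 2) (b ^ 2)) (hb : 0 < b) :
    ContDiffOn ℝ ∞ (fun x => κ * -(m x * p x)) (Ioo s t) := by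
  have hsub : Ioo s t ⊆ Ioo 0 1 := Ioo_subset_Ioo hs ht
  have hne : ∀ x ∈ Ioo s t, κ * -(m x * p x) ≠ 0 := fun x hx =>
    ((sq_pos_of_pos ha).trans (hint x hx).1).ne'
  have hsq : ∀ x ∈ Ioo s t, clampSqrt a b (κ * -(m x * p x)) = √(κ * -(m x * p x)) := by
    intro x hx
    have h1 : a < √(κ * -(m x * p x)) := Real.lt_sqrt_of_sq_lt (hint x hx).1
    have h2 : √(κ * -(m x * p x)) < b := (Real.sqrt_lt' hb).2 (hint x hx).2
    rw [clampSqrt, min_eq_right h2.le, max_eq_right h1.le]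
  have hsn : ∀ x ∈ Ioo s t, √(κ * -(m x * p x)) ≠ 0 := fun x hx => by
    rw [← hsq x hx]; exact (clampSqrt_pos ha _).ne'
  have hmul : ∀ n : ℕ, ContDiffOn ℝ n m (Ioo s t) → ContDiffOn ℝ n p (Ioo s t) →
      ContDiffOn ℝ n (fun x => κ * -(m x * p x)) (Ioo s t) := fun n hm hp =>
    contDiffOn_const.mul (hm.mul hp).neg
  have hsucc : ∀ (n : ℕ) (f f' : ℝ → ℝ), (∀ x ∈ Ioo s t, HasDerivAt f (f' x) x) →
      ContDiffOn ℝ n f' (Ioo s t) → ContDiffOn ℝ (n + 1 : ℕ) f (Ioo s t) := by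
    intro n f f' hf hf'
    rw [Nat.cast_add, Nat.cast_one, contDiffOn_succ_iff_deriv_of_isOpen isOpen_Ioo]
    refine ⟨fun x hx => (hf x hx).differentiableAt.differentiableWithinAt, by simp, ?_⟩
    exact hf'.congr fun x hx => (hf x hx).deriv
  -- Bootstrap: the right-hand sides of the four equations are smooth in k, P, m, p as long as the
  -- square root stays away from 0, so each round gains one derivative.
  have key : ∀ n : ℕ, ContDiffOn ℝ n k (Ioo s t) ∧ ContDiffOn ℝ n P (Ioo s t) ∧
      ContDiffOn ℝ n m (Ioo s t) ∧ ContDiffOn ℝ n p (Ioo s t) := by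
    intro n
    induction n with
    | zero =>
      simp only [Nat.cast_zero, contDiffOn_zero]
      exact ⟨h.continuous_k.continuousOn, h.continuous_P.continuousOn,
        h.continuous_m.continuousOn, h.continuous_p.continuousOn⟩
    | succ n ih =>
      obtain ⟨hk, hP, hm, hp⟩ := ih
      have hr : ContDiffOn ℝ n (fun x => √(κ * -(m x * p x))) (Ioo s t) := (hmul n hm hp).sqrt hne
      have hid : ContDiffOn ℝ n (fun x : ℝ => 1 - x) (Ioo s t) := by fun_prop
      refine ⟨hsucc n k _ (fun x hx => by
          have := h.hasDerivAt_k x (hsub hx); rwa [hsq x hx] at this) (hm.div hr hsn),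
        hsucc n P _ (fun x hx => by
          have := h.hasDerivAt_P x (hsub hx); rwa [hsq x hx] at this) (hp.div hr hsn),
        hsucc n m _ (fun x _ => h.hasDerivAt_m x) (hid.mul (Real.contDiff_cos.comp_contDiffOn hk)),
        hsucc n p _ (fun x _ => h.hasDerivAt_p x) (hid.mul
          ((Real.contDiff_cos.comp_contDiffOn hk).add
            ((Real.contDiff_sin.comp_contDiffOn hk).mul hP))).neg⟩
  exact contDiffOn_infty.2 fun n => hmul n (key n).2.2.1 (key n).2.2.2

/-- The shape of the design determined by an extremal. -/
lemma design_shape (ha : 0 < a) (hab : a < b) (hκ : 0 < κ) (h : IsExtremal a b κ k P m p)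
    {η : ℝ → ℝ} (hη : ∀ t, η t = (clampSqrt a b (κ * -(m t * p t)) - a) / (b - a)) :
    ContinuousOn η (Icc 0 1) ∧
      ((∀ t ∈ Icc (0 : ℝ) 1, η t = 0) ∨
        ∃ t₀ t₁ : ℝ, 0 ≤ t₀ ∧ t₀ < t₁ ∧ t₁ < 1 ∧
          (∀ t ∈ Ioo 0 t₀, η t = 1) ∧
          (∀ t ∈ Ioo t₀ t₁, 0 < η t) ∧
          StrictAntiOn η (Ioo t₀ t₁) ∧
          (∀ t ∈ Icc t₁ 1, η t = 0) ∧
          ContDiffOn ℝ ∞ η (Ioo t₀ t₁)) := by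
  obtain ⟨G, hG⟩ : ∃ G : ℝ → ℝ, G = fun t => κ * -(m t * p t) := ⟨_, rfl⟩
  have hGt : ∀ t, κ * -(m t * p t) = G t := fun t => by rw [hG]
  have hGc : Continuous G := by
    rw [hG]; exact continuous_const.mul (h.continuous_m.mul h.continuous_p).neg
  have hG1 : G 1 = 0 := by rw [hG]; simp [h.p_one]
  have hlt : ∀ s t, 0 ≤ s → s < t → t ≤ 1 → 0 < G t → G t < G s := fun s t hs hst ht hpos => by
    rw [← hGt] at hpos ⊢
    rw [← hGt]
    exact h.flux_mul_lt ha hκ hs hst ht hpos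
  simp only [hGt] at hη
  have hb : 0 < b := ha.trans hab
  have hd : 0 < b - a := sub_pos.2 hab
  have ha2 : 0 < a ^ 2 := sq_pos_of_pos ha
  have hab2 : a ^ 2 < b ^ 2 := by gcongr
  have hlow : ∀ t, G t ≤ a ^ 2 → η t = 0 := fun t ht => by
    have h1 : √(G t) ≤ a := Real.sqrt_le_iff.2 ⟨ha.le, ht⟩
    rw [hη, clampSqrt, max_eq_left ((min_le_right _ _).trans h1), sub_self, zero_div]
  have hhigh : ∀ t, b ^ 2 ≤ G t → η t = 1 := fun t ht => by
    have h1 : b ≤ √(G t) := Real.le_sqrt_of_sq_le ht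
    rw [hη, clampSqrt, min_eq_left h1, max_eq_right hab.le, div_self hd.ne']
  have hmid : ∀ t, G t ∈ Ioo (a ^ 2) (b ^ 2) → η t = (√(G t) - a) / (b - a) := fun t ht => by
    have h1 : a < √(G t) := Real.lt_sqrt_of_sq_lt ht.1
    have h2 : √(G t) < b := (Real.sqrt_lt' hb).2 ht.2
    rw [hη, clampSqrt, min_eq_right h2.le, max_eq_right h1.le]
  refine ⟨?_, ?_⟩
  · have : Continuous η := by
      rw [funext hη]
      exact (((continuous_clampSqrt a b).comp hGc).sub continuous_const).div_const _
    exact this.continuousOn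
  -- If G starts at or below a², it can never exceed a², since it decreases where positive.
  rcases le_or_gt (G 0) (a ^ 2) with h0 | h0
  · refine Or.inl fun t ht => hlow t ?_
    rcases ht.1.eq_or_lt with h1 | h1
    · rwa [← h1]
    · by_contra! hgt
      linarith [hlt 0 t le_rfl h1 ht.2 (ha2.trans hgt)]
  · right
    have hivt : ∀ y, 0 < y → y ≤ G 0 → ∃ t ∈ Icc (0 : ℝ) 1, G t = y := fun y hy hy' =>
      intermediate_value_Icc' zero_le_one hGc.continuousOn ⟨by rw [hG1]; exact hy.le, hy'⟩
    obtain ⟨t₁, ht₁, hGt₁⟩ := hivt (a ^ 2) ha2 h0.le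
    have ht₁0 : 0 < t₁ := lt_of_le_of_ne ht₁.1 (by rintro rfl; linarith)
    have ht₁1 : t₁ < 1 := lt_of_le_of_ne ht₁.2 (by rintro rfl; linarith)
    obtain ⟨t₀, ht₀, ht₀₁, hle₀, hone⟩ : ∃ t₀, 0 ≤ t₀ ∧ t₀ < t₁ ∧
        (∀ t ∈ Ioo t₀ t₁, G t < b ^ 2) ∧ ∀ t ∈ Ioo 0 t₀, η t = 1 := by
      -- Either G never exceeds b² and no saturated piece occurs, or t₀ is the point where G crosses
      -- b².
      rcases le_or_gt (G 0) (b ^ 2) with h2 | h2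
      · refine ⟨0, le_rfl, ht₁0, fun t ht => ?_, fun t ht => absurd ht (by simp)⟩
        have h3 := hlt t t₁ ht.1.le ht.2 ht₁.2 (by rw [hGt₁]; exact ha2)
        rw [hGt₁] at h3
        exact (hlt 0 t le_rfl ht.1 (ht.2.le.trans ht₁.2) (ha2.trans h3)).trans_le h2
      · obtain ⟨t₀, ht₀, hGt₀⟩ := hivt (b ^ 2) (sq_pos_of_pos hb) h2.le
        have hb2 : 0 < G t₀ := by rw [hGt₀]; exact sq_pos_of_pos hb
        refine ⟨t₀, ht₀.1, ?_, fun t ht => ?_, fun t ht => hhigh t ?_⟩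
        · by_contra! hle
          rcases hle.eq_or_lt with h3 | h3
          · rw [h3] at hGt₁; linarith
          · have := hlt t₁ t₀ ht₁.1 h3 ht₀.2 hb2
            linarith
        · have h3 := hlt t t₁ (ht₀.1.trans ht.1.le) ht.2 ht₁.2 (by rw [hGt₁]; exact ha2)
          rw [hGt₁] at h3
          rw [← hGt₀]
          exact hlt t₀ t ht₀.1 ht.1 (ht.2.le.trans ht₁.2) (ha2.trans h3)
        · rw [← hGt₀]
          exact (hlt t t₀ ht.1.le ht.2 ht₀.2 hb2).le
    have hgt : ∀ t ∈ Ioo t₀ t₁, a ^ 2 < G t := fun t ht => by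
      rw [← hGt₁]
      exact hlt t t₁ (ht₀.trans ht.1.le) ht.2 ht₁.2 (by rw [hGt₁]; exact ha2)
    have hbetween : ∀ t ∈ Ioo t₀ t₁, G t ∈ Ioo (a ^ 2) (b ^ 2) := fun t ht =>
      ⟨hgt t ht, hle₀ t ht⟩
    refine ⟨t₀, t₁, ht₀, ht₀₁, ht₁1, hone, fun t ht => ?_, fun s hs t ht hst => ?_,
      fun t ht => hlow t ?_, ?_⟩
    · rw [hmid t (hbetween t ht)]
      exact div_pos (sub_pos.2 (Real.lt_sqrt_of_sq_lt (hgt t ht))) hd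
    · rw [hmid t (hbetween t ht), hmid s (hbetween s hs)]
      have h1 := hlt s t (ht₀.trans hs.1.le) hst (ht.2.le.trans ht₁.2) (ha2.trans (hgt t ht))
      have h2 := Real.sqrt_lt_sqrt (ha2.trans (hgt t ht)).le h1
      exact div_lt_div_of_pos_right (by linarith) hd
    · rcases ht.1.eq_or_lt with h1 | h1
      · rw [← h1, hGt₁]
      · by_contra! hgt'
        linarith [hlt t₁ t ht₁.1 h1 ht.2 (ha2.trans hgt')]
    · have hGs : ContDiffOn ℝ ∞ G (Ioo t₀ t₁) := by
        rw [hG]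
        exact h.contDiffOn_flux_mul ha ht₀ ht₁.2 (fun t ht => by
          rw [hGt]; exact hbetween t ht) hb
      have : ContDiffOn ℝ ∞ (fun t => (√(G t) - a) / (b - a)) (Ioo t₀ t₁) :=
        ((hGs.sqrt fun t ht => (ha2.trans (hgt t ht)).ne').sub contDiffOn_const).div_const _
      exact this.congr fun t ht => hmid t (hbetween t ht)

end IsExtremal

/-! ### From optimal designs to extremals -/

lemma hasDerivAt_integral_left {ψ : ℝ → ℝ} (hψ : Continuous ψ) (t : ℝ) :
    HasDerivAt (fun t => -∫ s in t..1, ψ s) (ψ t) t := by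
  have := (intervalIntegral.integral_hasDerivAt_left (hψ.intervalIntegrable t 1)
    (hψ.stronglyMeasurableAtFilter _ _) hψ.continuousAt).fun_neg
  simpa using this

/-- Upgrades almost everywhere differentiability of the state to every interior point, once its
derivative has a continuous representative. -/
lemma hasDerivAt_prim_of_ae_eq {u v : ℝ → ℝ} (hv : Continuous v) (huv : u =ᵐ[unitVol] v) {t : ℝ}
    (ht : t ∈ Ioo (0 : ℝ) 1) : HasDerivAt (prim u) (v t) t := by
  rw [prim_congr huv]
  have h1 : HasDerivAt (fun t => ∫ s in (0 : ℝ)..t, v s) (v t) t :=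
    intervalIntegral.integral_hasDerivAt_right (hv.intervalIntegrable 0 t)
      (hv.stronglyMeasurableAtFilter _ _) hv.continuousAt
  refine h1.congr_of_eventuallyEq ?_
  filter_upwards [isOpen_Ioo.mem_nhds ht] with s hs
  exact prim_eq_integral v (Ioo_subset_Icc_self hs)

lemma clampSqrt_eq_of_sign {a b c x θ : ℝ} (ha : 0 < a) (hab : a < b) (hc : 0 < c)
    (hθ : θ ∈ Icc (0 : ℝ) 1)
    (hpos : 0 < (b - a) * (x / ((1 - θ) * a + θ * b) ^ 2) + c → θ = 0)
    (hneg : (b - a) * (x / ((1 - θ) * a + θ * b) ^ 2) + c < 0 → θ = 1) :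
    clampSqrt a b ((b - a) / c * -x) = (1 - θ) * a + θ * b := by
  have hd : 0 < b - a := sub_pos.2 hab
  set B := (1 - θ) * a + θ * b with hB
  have hBa : a ≤ B := by rw [hB]; nlinarith [hθ.1]
  have hBb : B ≤ b := by rw [hB]; nlinarith [hθ.2]
  have hB0 : 0 < B := ha.trans_le hBa
  -- The sign of the switching function decides on which side of B² the argument of the square root
  -- lies. A negative argument is harmless: its `√` is 0, which is clamped to a.
  have hkey : (b - a) / c * -x = B ^ 2 - B ^ 2 / c * ((b - a) * (x / B ^ 2) + c) := by
    field_simp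
    ring
  have hBc : 0 < B ^ 2 / c := by positivity
  unfold clampSqrt
  rcases lt_trichotomy ((b - a) * (x / B ^ 2) + c) 0 with h | h | h
  · have hθ1 := hneg h
    have hBeq : B = b := by rw [hB, hθ1]; ring
    have h1 : B ^ 2 ≤ (b - a) / c * -x := by
      rw [hkey]; nlinarith
    rw [min_eq_left (hBeq.symm.trans_le (Real.le_sqrt_of_sq_le h1)), max_eq_right hab.le, hBeq]
  · rw [hkey, h, mul_zero, sub_zero, Real.sqrt_sq hB0.le, min_eq_right hBb, max_eq_right hBa]
  · have hθ0 := hpos h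
    have hBeq : B = a := by rw [hB, hθ0]; ring
    have h1 : (b - a) / c * -x ≤ B ^ 2 := by
      rw [hkey]; nlinarith
    have h2 : √((b - a) / c * -x) ≤ a :=
      (Real.sqrt_le_iff.2 ⟨hB0.le, h1⟩).trans_eq hBeq
    rw [max_eq_left ((min_le_right _ _).trans h2), hBeq]

/-- An optimal design is determined almost everywhere by an extremal. -/
lemma IsOptimalDesign.exists_extremal {a b c : ℝ} {θ : ℝ → ℝ} (ha : 0 < a) (hab : a < b)
    (hc : 0 < c) (hθ : IsOptimalDesign a b c θ) :
    ∃ k P m p, IsExtremal a b ((b - a) / c) k P m p ∧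
      (fun t => (clampSqrt a b ((b - a) / c * -(m t * p t)) - a) / (b - a)) =ᵐ[unitVol] θ := by
  have hB := isCoeff_hardness hab hθ.1
  have hK := isPhase_phase hB ha
  obtain ⟨q, hq, hqEL⟩ := exists_adjoint hB ha hK
  have hsign := hθ.ae_sign_condition ha hab hq hqEL
  set B := hardness a b θ
  set u := deriv (phase B)
  have hu : MemLp u 2 unitVol := hK.1.2.1
  have hck := continuous_prim (integrable_of_memLp_two hu)
  have hcP := continuous_prim (integrable_of_memLp_two hq)
  have hfu := ae_flux_eq hB ha isPotential_gravity.continuous_deriv hu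
    fun h hh => hK.firstVar_eq_zero hB ha hh
  have hfq := ae_flux_eq hB ha (isPotential_adjoint hck).continuous_deriv hq hqEL
  have hcm : Continuous fun s => gravity' s (prim u s) := by unfold gravity'; fun_prop
  have hcp : Continuous fun s => adjoint' (prim u) s (prim q s) := by unfold adjoint'; fun_prop
  set m : ℝ → ℝ := fun t => -∫ s in t..1, gravity' s (prim u s) with hm
  set p : ℝ → ℝ := fun t => -∫ s in t..1, adjoint' (prim u) s (prim q s) with hp
  have hdm : ∀ t, HasDerivAt m (gravity' t (prim u t)) t := hasDerivAt_integral_left hcm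
  have hdp : ∀ t, HasDerivAt p (adjoint' (prim u) t (prim q t)) t := hasDerivAt_integral_left hcp
  have hmc : Continuous m := continuous_iff_continuousAt.2 fun t => (hdm t).continuousAt
  have hpc : Continuous p := continuous_iff_continuousAt.2 fun t => (hdp t).continuousAt
  have hclamp : ∀ᵐ t ∂unitVol, clampSqrt a b ((b - a) / c * -(m t * p t)) = B t := by
    filter_upwards [hsign, hfu, hfq, hB.mem_Icc, hθ.1.2] with t h1 h2 h3 h4 h5
    have hB0 : B t ≠ 0 := (ha.trans_le h4.1).ne'
    have h2' : B t * u t = m t := h2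
    have h3' : B t * q t = p t := h3
    have e : u t * q t = m t * p t / B t ^ 2 := by
      rw [eq_div_iff (pow_ne_zero 2 hB0), ← h2', ← h3']; ring
    rw [e] at h1
    exact clampSqrt_eq_of_sign ha hab hc h5 h1.1 h1.2
  have hβc : Continuous fun t => clampSqrt a b ((b - a) / c * -(m t * p t)) :=
    (continuous_clampSqrt a b).comp (continuous_const.mul (hmc.mul hpc).neg)
  have hβ0 : ∀ t, clampSqrt a b ((b - a) / c * -(m t * p t)) ≠ 0 := fun t =>
    (IsExtremal.clampSqrt_pos ha _).ne'
  -- The clamped hardness is continuous and positive, so dividing the fluxes by it gives continuous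
  -- representatives of both derivatives.
  have hu' : u =ᵐ[unitVol] fun t => m t / clampSqrt a b ((b - a) / c * -(m t * p t)) := by
    filter_upwards [hclamp, hfu] with t h1 h2
    rw [eq_div_iff (hβ0 t), h1, mul_comm]; exact h2
  have hq' : q =ᵐ[unitVol] fun t => p t / clampSqrt a b ((b - a) / c * -(m t * p t)) := by
    filter_upwards [hclamp, hfq] with t h1 h2
    rw [eq_div_iff (hβ0 t), h1, mul_comm]; exact h2
  refine ⟨prim u, prim q, m, p, ⟨hck, hcP, fun t ht => hK.prim_mem hB ha ht, hdm, fun t => ?_,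
    by simp [hm], by simp [hp], fun t ht => hasDerivAt_prim_of_ae_eq (hmc.div hβc hβ0) hu' ht,
    fun t ht => hasDerivAt_prim_of_ae_eq (hpc.div hβc hβ0) hq' ht⟩, ?_⟩
  · convert hdp t using 1
    unfold adjoint'
    ring
  · filter_upwards [hclamp] with t ht
    rw [ht, div_eq_iff (sub_pos.2 hab).ne']
    simp only [B, hardness]
    ring

end PlateDesign

end

theorem theorem6p2 (a b c : ℝ) (ha : 0 < a) (hab : a < b) (hc : 0 < c)
    (θ : ℝ → ℝ) (hθ : PlateDesign.IsOptimalDesign a b c θ) :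
    ∃ η : ℝ → ℝ, η =ᵐ[volume.restrict (Ioo (0 : ℝ) 1)] θ ∧
      ContinuousOn η (Icc 0 1) ∧
      ((∀ t ∈ Icc (0 : ℝ) 1, η t = 0) ∨
        ∃ t₀ t₁ : ℝ, 0 ≤ t₀ ∧ t₀ < t₁ ∧ t₁ < 1 ∧
          (∀ t ∈ Ioo 0 t₀, η t = 1) ∧
          (∀ t ∈ Ioo t₀ t₁, 0 < η t) ∧
          StrictAntiOn η (Ioo t₀ t₁) ∧
          (∀ t ∈ Icc t₁ 1, η t = 0) ∧
          ContDiffOn ℝ ∞ η (Ioo t₀ t₁)) := by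
  obtain ⟨k, P, m, p, hext, hη⟩ := hθ.exists_extremal ha hab hc
  exact ⟨_, hη, hext.design_shape ha hab (div_pos (sub_pos.2 hab) hc) fun _ => rfl⟩
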